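/- \textbf{Definitions.} Let $F$ be a field. A non-commutative arithmetic circuit over $F$ in the variables $x_1,\dots,x_n$ is a directed acyclic graph with a distinguished root, whose leaves are labelled by variables or by constants of $F$ and whose internal gates are $+$ gates and $\times$ gates (of arbitrary fan-in, the children of a $\times$ gate being ordered); it computes an element of $F\langle x_1,\dots,x_n\rangle$, and its size is its number of gates. A parse tree of the circuit is obtained by starting at the root and taking exactly one child at every $+$ gate and all children, in order, at every $\times$ gate. The shape of a parse tree is the ordered tree obtained by forgetting the names of the gates and keeping only their kinds ($+$, $\times$, variable leaf, constant leaf). The circuit is a \emph{unique-parse-tree (UPT) circuit} if all its parse trees have the same shape. Let $\mathcal C_{F}(d,n,s)$ be the set of homogeneous polynomials of degree $d$ in $F\langle x_1,\dots,x_n\rangle$ computed by UPT circuits over $F$ of size at most $s$. \textbf{Theorem (hitting sets for UPT circuits).} There are a deterministic algorithm and an absolute constant $c$ such that the following holds for all $d,n,s\ge 1$. On input $(d,n,s)$ the algorithm makes at most $(snd+1)^{c(\lfloor\log_2 d\rfloor+1)}$ elementary steps and prints a list of $m\le (snd+1)^{c(\lfloor\log_2 d\rfloor+1)}$ points, where a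 point is an $n$-tuple of $(d+1)\times(d+1)$ matrices and each matrix entry is given either as $0$ or as a power $\alpha^{e}$ (by the exponent $e\in\mathbb N$) of a parameter $\alpha$. For every field $F$, every extension field $K$ of $F$ (for instance $K=F$ if $F$ is infinite) and every $\alpha\in K$ whose powers $\alpha^i$, $0\le i<(snd+1)^{c}$, are pairwise distinct, the resulting set $\mathcal H_{d,n,s}\subseteq \big(K^{(d+1)\times(d+1)}\big)^n$ is a hitting set for $\mathcal C_F(d,n,s)$: for every nonzero $f\in\mathcal C_F(d,n,s)$ there is $(A_1,\dots,A_n)\in\mathcal H_{d,n,s}$ with $f(A_1,\dots,A_n)\neq 0$. In particular there is an explicit hitting set of size $(snd)^{O(\log d)}$ for $n$-variate homogeneous non-commutative polynomials of degree $d$ computed by UPT circuits of size at most $s$, and the shape of the parse trees need not be known. Elementary steps are the transitions of a list machine (Mathlib's machine for \texttt{Turing.ToPartrec.Code}): increment or decrement the first entry of a list of natural numbers, push or drop an entry, test for zero. -/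

import Mathlib

namespace UPT

/-! ### Non-commutative polynomials -/

/-- The space of homogeneous polynomials of degree `d` in the free algebra on `x_1, …, x_n`:
the linear span of the words of length `d`. -/
def homogeneous (F : Type*) [Field F] (n d : ℕ) : Submodule F (FreeAlgebra F (Fin n)) :=
  Submodule.span F
    {p | ∃ w : List (Fin n), w.length = d ∧ p = (w.map (FreeAlgebra.ι F)).prod}

/-! ### Non-commutative arithmetic circuits -/

/-- A gate of a non-commutative circuit whose children are chosen among `k` given gates:
a leaf labelled by a variable or by a field constant, a sum gate, or a product gate with an
ordered list of children. Fan-in is unbounded. -/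
inductive Gate (F : Type*) (n k : ℕ) where
  | var (i : Fin n)
  | const (c : F)
  | add (children : List (Fin k))
  | mul (children : List (Fin k))

/-- A non-commutative arithmetic circuit: a directed acyclic graph of gates, numbered in a
topological order, so that the children of gate `v` are among the gates `0, …, v - 1`. The size
is the number of gates. -/
structure Circuit (F : Type*) (n : ℕ) where
  size : ℕ
  gate : (v : Fin size) → Gate F n v
  root : Fin size

/-- A gate below `v`, as a gate of the whole circuit. -/
def below {N : ℕ} (v : Fin N) (u : Fin v) : Fin N := ⟨u, u.isLt.trans v.isLt⟩

/-- The polynomial computed at the gate `v`. -/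
noncomputable def Circuit.val {F : Type*} [Field F] {n : ℕ} (C : Circuit F n)
    (v : Fin C.size) : FreeAlgebra F (Fin n) :=
  match C.gate v with
  | .var i => FreeAlgebra.ι F i
  | .const c => algebraMap F (FreeAlgebra F (Fin n)) c
  | .add cs => (cs.map fun u => C.val (below v u)).sum
  | .mul cs => (cs.map fun u => C.val (below v u)).prod
termination_by v.val
decreasing_by all_goals exact u.isLt

/-- The polynomial computed by the circuit. -/
noncomputable def Circuit.poly {F : Type*} [Field F] {n : ℕ} (C : Circuit F n) :
    FreeAlgebra F (Fin n) :=
  C.val C.root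

/-! ### Parse trees and unique-parse-tree circuits -/

/-- Finite ordered trees with labelled nodes. -/
inductive PTree (α : Type*) where
  | node (a : α) (children : List (PTree α))

/-- The label of the root of a tree. -/
def PTree.label {α : Type*} : PTree α → α
  | .node a _ => a

/-- Relabel all the nodes of a tree. -/
def PTree.map {α β : Type*} (φ : α → β) : PTree α → PTree β
  | .node a ts => .node (φ a) (ts.map fun t => t.map φ)

/-- The children that a gate `v` may have in a parse tree: none for a leaf, exactly one of its
children in the circuit for a sum gate, all of its children in the circuit, in the same order,
for a product gate. -/
def Circuit.Chooses {F : Type*} {n : ℕ} (C : Circuit F n) (v : Fin C.size)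
    (us : List (Fin C.size)) : Prop :=
  match C.gate v with
  | .var _ => us = []
  | .const _ => us = []
  | .add cs => ∃ u ∈ cs, us = [below v u]
  | .mul cs => us = cs.map (below v)

/-- `C.IsPartialParseTree T`: the tree `T` of gate names is a parse tree of the subcircuit of `C`
below the gate at the root of `T`. -/
inductive Circuit.IsPartialParseTree {F : Type*} {n : ℕ} (C : Circuit F n) :
    PTree (Fin C.size) → Prop where
  | node (v : Fin C.size) (ts : List (PTree (Fin C.size)))
      (hts : ∀ t ∈ ts, C.IsPartialParseTree t) (hv : C.Chooses v (ts.map PTree.label)) :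
      C.IsPartialParseTree (.node v ts)

/-- `T` is a parse tree of `C`. -/
def Circuit.IsParseTree {F : Type*} {n : ℕ} (C : Circuit F n) (T : PTree (Fin C.size)) : Prop :=
  C.IsPartialParseTree T ∧ T.label = C.root

/-- The kinds of gates. -/
inductive Kind where
  | var
  | const
  | add
  | mul

/-- The kind of a gate. -/
def Gate.kind {F : Type*} {n k : ℕ} : Gate F n k → Kind
  | .var _ => .var
  | .const _ => .const
  | .add _ => .add
  | .mul _ => .mul

/-- The shape of a tree of gates: the gate names are forgotten, only the kind of each gate
(variable leaf, constant leaf, sum, product) is kept. -/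
def Circuit.shape {F : Type*} {n : ℕ} (C : Circuit F n) (T : PTree (Fin C.size)) : PTree Kind :=
  T.map fun v => (C.gate v).kind

/-- All parse trees of `C` have the same shape. -/
def Circuit.IsUPT {F : Type*} {n : ℕ} (C : Circuit F n) : Prop :=
  ∀ T T' : PTree (Fin C.size), C.IsParseTree T → C.IsParseTree T' → C.shape T = C.shape T'

/-- The `n`-variate homogeneous polynomials of degree `d` over `F` that are computed by UPT
circuits of size at most `s`. -/
def computable (F : Type*) [Field F] (d n s : ℕ) : Set (FreeAlgebra F (Fin n)) :=
  {f | f ∈ homogeneous F n d ∧ ∃ C : Circuit F n, C.IsUPT ∧ C.size ≤ s ∧ C.poly = f}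

/-! ### Hitting sets -/

/-- `H`, a set of `n`-tuples of `r × r` matrices over `K`, is a hitting set for the class `P` of
non-commutative polynomials: every nonzero polynomial in `P` takes a nonzero value at some point
of `H`. -/
def IsHittingSet {F K : Type*} [Field F] [Field K] [Algebra F K] {n r : ℕ}
    (P : Set (FreeAlgebra F (Fin n))) (H : Set (Fin n → Matrix (Fin r) (Fin r) K)) : Prop :=
  ∀ f ∈ P, f ≠ 0 → ∃ h ∈ H, FreeAlgebra.lift F h f ≠ 0

/-! ### Explicitness -/

/-- The program `c`, started on the list of numbers `input`, halts with the list `output` after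
at most `t` steps.

The machine is Mathlib's abstract machine for `Turing.ToPartrec.Code`, and a step is one transition
`Turing.ToPartrec.step`. In one step only a bounded number (depending on `c` only, amortized over
the run) of elementary list operations are made: increment or decrement the first entry, push an
entry, drop the first entry, test the first entry for zero. In particular numbers grow by at most
one per step, and `t` steps can be simulated by a Turing machine in time polynomial in `t` and
the numbers and length of the input. -/
def RunsInTime (c : Turing.ToPartrec.Code) (input output : List ℕ) (t : ℕ) : Prop :=
  Nonempty (StateTransition.EvalsToInTime Turing.ToPartrec.step
    (Turing.ToPartrec.stepNormal c Turing.ToPartrec.Cont.halt input)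
    (some (Turing.ToPartrec.Cfg.halt output)) t)

/-- The field element that a number stands for, with respect to a fixed element `α` of the field:
`0` stands for `0`, and `e + 1` stands for `α ^ e`. -/
def entry {K : Type*} [Field K] (α : K) : ℕ → K
  | 0 => 0
  | e + 1 => α ^ e

/-- The `k`-th `n`-tuple of `r × r` matrices that is written in the list `L`. Tuples are written
one after the other, each of them as a sequence of `n` matrices, each matrix row by row, and each
matrix entry as a number that stands for a field element. -/
def point {K : Type*} [Field K] (α : K) (n r : ℕ) (L : List ℕ) (k : ℕ) :
    Fin n → Matrix (Fin r) (Fin r) K :=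
  fun j => Matrix.of fun a b => entry α (L.getD (((k * n + j) * r + a) * r + b) 0)

/-- The set of the first `m` tuples that are written in the list `L`. -/
def pointSet {K : Type*} [Field K] (α : K) (n r m : ℕ) (L : List ℕ) :
    Set (Fin n → Matrix (Fin r) (Fin r) K) :=
  {h | ∃ k < m, h = point α n r L k}

end UPT

namespace UPT

open Turing.ToPartrec

/-! ### Running times of codes -/

/-! A homogeneous polynomial of degree d is a tensor f indexed by words of length d. At matrices
supported on the superdiagonal, with entry y_a(i) in row a of the i-th matrix, the (0, d) entry of
the value is ∑_m f(m) ∏_j y_j(m_j) (`lift_apply_zero_last`). So it suffices to list few weights w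
such that y_j(i) = α^{w_j(i)} keeps one of these sums nonzero.

Unique parse trees bound ranks. Gates of one shape at one place of the parse tree are homogeneous of
one degree and fill the same interval of positions. Hence the polynomial lies in (degree
a)·span(gates)·(degree b), and the flattening along this interval has rank at most the size of the
circuit. This gives a tree of position sets of small rank (`posTree_of_uniform`). Splitting at
separators makes its depth O(log d) (`decomp_of_tree`). The new sets are differences of old ones and
have rank at most s², since complements transpose the flattening and ranks are submultiplicative
under disjoint unions (`flatRank_sdiff_le`).

Along the balanced tree a weight is built bottom-up. For each set I at a level there are at most R =
s² + n words such that all other rows of the flattening are combinations of strictly lighter rows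
among theirs (`Isolates`). For a disjoint union the two word sets are glued. A hash in the lower
digits separates the at most R² results (`Isolates.union`), and dependent rows are discarded
(`Isolates.prune`). One hash per level serves all sets of that level
(`exists_levelWeight_isolates`). For the full set of positions a lightest word with nonzero
coefficient is then alone in its weight class.

This weight is exponentially large in the number of levels. Each level is therefore read as a
separate variable of degree below b and replaced by a small power of α (`exists_expWeight`). A level
costs a triple (exponent, hash base, modulus) of numbers below b = (snd+1)^{33}. The O(log d)
triples are the digits of the index of a point, so running through all indices covers every shape
and yields (snd)^{O(log d)} points. What remains is that the entries are computed within the time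
bound (`exists_program`). -/

/-- Started on `v`, the code `c` returns `o` to its continuation after at most `t` transitions. -/
def Runs (c : Code) (v o : List ℕ) (t : ℕ) : Prop :=
  ∀ k : Cont, ∃ t' ≤ t, (flip bind step)^[t'] (some (stepNormal c k v)) = some (stepRet k o)

theorem Runs.mono {c : Code} {v o : List ℕ} {t t' : ℕ} (h : Runs c v o t) (ht : t ≤ t') :
    Runs c v o t' := fun k => by
  obtain ⟨u, hu, e⟩ := h k
  exact ⟨u, hu.trans ht, e⟩

theorem Runs.runsInTime {c : Code} {v o : List ℕ} {t : ℕ} (h : Runs c v o t) :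
    RunsInTime c v o t := by
  obtain ⟨u, hu, e⟩ := h Cont.halt
  exact ⟨⟨⟨u, e⟩, hu⟩⟩

theorem runs_zero (v : List ℕ) : Runs Code.zero' v (0 :: v) 1 := fun _ => ⟨1, le_rfl, rfl⟩

theorem runs_succ (v : List ℕ) : Runs Code.succ v [v.headI.succ] 1 := fun _ => ⟨1, le_rfl, rfl⟩

theorem runs_tail (v : List ℕ) : Runs Code.tail v v.tail 1 := fun _ => ⟨1, le_rfl, rfl⟩

theorem Runs.cons {f fs : Code} {v o os : List ℕ} {t ts : ℕ} (h : Runs f v o t)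
    (hs : Runs fs v os ts) : Runs (Code.cons f fs) v (o.headI :: os) (t + ts) := fun k => by
  obtain ⟨u, hu, e⟩ := h (Cont.cons₁ fs v k)
  obtain ⟨u', hu', e'⟩ := hs (Cont.cons₂ o k)
  refine ⟨u' + u, by omega, ?_⟩
  rw [Function.iterate_add_apply]
  change (flip bind step)^[u'] ((flip bind step)^[u] (some (stepNormal f (Cont.cons₁ fs v k) v))) = _
  rw [e]
  exact e'

theorem Runs.comp {f g : Code} {v o o' : List ℕ} {t t' : ℕ} (hg : Runs g v o t)
    (hf : Runs f o o' t') : Runs (Code.comp f g) v o' (t + t') := fun k => by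
  obtain ⟨u, hu, e⟩ := hg (Cont.comp f k)
  obtain ⟨u', hu', e'⟩ := hf k
  refine ⟨u' + u, by omega, ?_⟩
  rw [Function.iterate_add_apply]
  change (flip bind step)^[u'] ((flip bind step)^[u] (some (stepNormal g (Cont.comp f k) v))) = _
  rw [e]
  exact e'

theorem Runs.case_zero {f g : Code} {v o : List ℕ} {t : ℕ} (h : Runs f v o t) :
    Runs (Code.case f g) (0 :: v) o t := h

theorem Runs.case_succ {f g : Code} {v o : List ℕ} {n t : ℕ} (h : Runs g (n :: v) o t) :
    Runs (Code.case f g) ((n + 1) :: v) o t := h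

theorem Runs.fix_stop {f : Code} {v o : List ℕ} {t : ℕ} (h : Runs f v (0 :: o) t) :
    Runs (Code.fix f) v o t := fun k => by
  obtain ⟨u, hu, e⟩ := h (Cont.fix f k)
  exact ⟨u, hu, e⟩

theorem Runs.fix_next {f : Code} {v o o' : List ℕ} {n t t' : ℕ} (h : Runs f v ((n + 1) :: o) t)
    (h' : Runs (Code.fix f) o o' t') : Runs (Code.fix f) v o' (t + t') := fun k => by
  obtain ⟨u, hu, e⟩ := h (Cont.fix f k)
  obtain ⟨u', hu', e'⟩ := h' k
  refine ⟨u' + u, by omega, ?_⟩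
  rw [Function.iterate_add_apply]
  change (flip bind step)^[u'] ((flip bind step)^[u] (some (stepNormal f (Cont.fix f k) v))) = _
  rw [e]
  exact e'

theorem runs_id (v : List ℕ) : Runs Code.id v v 2 := (runs_zero v).comp (runs_tail _)

/-- The code `c` computes the number `y` from `v`, as the first entry of its result, in time `t`. -/
def Gives (c : Code) (v : List ℕ) (y t : ℕ) : Prop := ∃ o, o.headI = y ∧ Runs c v o t

theorem Gives.mono {c : Code} {v : List ℕ} {y t t' : ℕ} (h : Gives c v y t) (ht : t ≤ t') :
    Gives c v y t' := by
  obtain ⟨o, e, r⟩ := h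
  exact ⟨o, e, r.mono ht⟩

theorem Gives.cons {f fs : Code} {v os : List ℕ} {y t ts : ℕ} (h : Gives f v y t)
    (hs : Runs fs v os ts) : Runs (Code.cons f fs) v (y :: os) (t + ts) := by
  obtain ⟨o, rfl, r⟩ := h
  exact r.cons hs

theorem Runs.gives {f g : Code} {v o : List ℕ} {y t t' : ℕ} (hg : Runs g v o t)
    (hf : Gives f o y t') : Gives (Code.comp f g) v y (t + t') := by
  obtain ⟨o', rfl, r⟩ := hf
  exact ⟨o', rfl, hg.comp r⟩

/-- The constant code `1`. -/
def codeOne : Code := Code.comp Code.succ Code.zero'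

theorem gives_one (v : List ℕ) : Gives codeOne v 1 2 :=
  ⟨_, rfl, (runs_zero v).comp (runs_succ _)⟩

/-- The body of a counting loop on states `remaining :: i :: acc :: v`. -/
def loopBody (h : Code) : Code :=
  Code.case Code.zero' (Code.cons codeOne (Code.cons Code.id (Code.cons (Code.comp Code.succ Code.tail)
    (Code.cons (Code.comp h Code.tail) (Code.comp Code.tail (Code.comp Code.tail Code.tail))))))

/-- Each pass costs the time of `h` plus 10 transitions; the factor `n + 1` includes the last pass,
which only finds the counter at zero. -/
theorem runs_loop {h : Code} {v : List ℕ} {r : ℕ → ℕ} {N T : ℕ}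
    (hr : ∀ i < N, Gives h (i :: r i :: v) (r (i + 1)) T) :
    ∀ n i, i + n = N →
      Runs (Code.fix (loopBody h)) (n :: i :: r i :: v) (N :: r N :: v) ((n + 1) * (T + 10)) := by
  intro n
  induction n with
  | zero =>
    intro i hi
    obtain rfl : i = N := by omega
    exact (Runs.fix_stop (Runs.case_zero (runs_zero _))).mono (by omega)
  | succ n ih =>
    intro i hi
    have b : Runs (loopBody h) ((n + 1) :: i :: r i :: v)
        (1 :: n :: (i + 1) :: r (i + 1) :: v) (2 + (2 + ((1 + 1) + ((1 + T) + ((1 + 1) + 1))))) :=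
      Runs.case_succ <| (gives_one _).cons <| (Gives.cons ⟨_, rfl, runs_id _⟩) <|
        (Gives.cons ⟨_, rfl, (runs_tail _).comp (runs_succ _)⟩) <|
        ((runs_tail _).gives (hr i (by omega))).cons <|
        ((runs_tail _).comp (runs_tail _)).comp (runs_tail _)
    exact (b.fix_next (ih (i + 1) (by omega))).mono (by nlinarith)

/-! ### Functions of polynomial running time -/

/-- `f` is bounded by a fixed power of the largest argument. -/
def PolyBdd (f : List ℕ → ℕ) : Prop :=
  ∃ e, ∀ B v, 2 ≤ B → (∀ x ∈ v, x ≤ B) → f v ≤ B ^ e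

/-- `f` is computed by a code, in time bounded by a fixed power of the largest argument. -/
def PolyTime (f : List ℕ → ℕ) : Prop :=
  PolyBdd f ∧ ∃ c e, ∀ B v, 2 ≤ B → (∀ x ∈ v, x ≤ B) → Gives c v (f v) (B ^ e)

theorem PolyTime.bdd {f : List ℕ → ℕ} (h : PolyTime f) : PolyBdd f := h.1

theorem PolyBdd.mono {f g : List ℕ → ℕ} (hf : PolyBdd f) (h : ∀ v, g v ≤ f v) : PolyBdd g := by
  obtain ⟨e, he⟩ := hf
  exact ⟨e, fun B v hB hv => (h v).trans (he B v hB hv)⟩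

theorem one_le_pow_of_two_le {B : ℕ} (hB : 2 ≤ B) (e : ℕ) : 1 ≤ B ^ e :=
  Nat.one_le_pow _ _ (by omega)

theorem const_le_pow {B : ℕ} (hB : 2 ≤ B) (n : ℕ) : n ≤ B ^ n :=
  (Nat.lt_pow_self (by omega)).le

theorem pow_le_pow_of_two_le {B : ℕ} (hB : 2 ≤ B) {e e' : ℕ} (h : e ≤ e') : B ^ e ≤ B ^ e' :=
  Nat.pow_le_pow_right (by omega) h

theorem add_le_pow {B x y e e' : ℕ} (hB : 2 ≤ B) (hx : x ≤ B ^ e) (hy : y ≤ B ^ e') :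
    x + y ≤ B ^ (e + e' + 1) := by
  have h1 := pow_le_pow_of_two_le hB (Nat.le_add_right e e')
  have h2 := pow_le_pow_of_two_le hB (Nat.le_add_left e' e)
  rw [pow_succ]
  nlinarith

theorem mul_le_pow {B x y e e' : ℕ} (hx : x ≤ B ^ e) (hy : y ≤ B ^ e') :
    x * y ≤ B ^ (e + e') := by
  rw [pow_add]
  exact Nat.mul_le_mul hx hy

theorem PolyBdd.const (n : ℕ) : PolyBdd fun _ => n := ⟨n, fun _ _ hB _ => const_le_pow hB n⟩

theorem PolyBdd.add {f g : List ℕ → ℕ} (hf : PolyBdd f) (hg : PolyBdd g) :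
    PolyBdd fun v => f v + g v := by
  obtain ⟨e, he⟩ := hf
  obtain ⟨e', he'⟩ := hg
  exact ⟨_, fun B v hB hv => add_le_pow hB (he B v hB hv) (he' B v hB hv)⟩

theorem PolyBdd.mul {f g : List ℕ → ℕ} (hf : PolyBdd f) (hg : PolyBdd g) :
    PolyBdd fun v => f v * g v := by
  obtain ⟨e, he⟩ := hf
  obtain ⟨e', he'⟩ := hg
  exact ⟨_, fun B v hB hv => mul_le_pow (he B v hB hv) (he' B v hB hv)⟩

theorem PolyTime.const (n : ℕ) : PolyTime fun _ => n := by
  refine ⟨PolyBdd.const n, ?_⟩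
  suffices h : ∃ c : Code, ∀ v, Runs c v (n :: v) (2 * n + 1) ∨ Gives c v n (2 * n + 2) by
    obtain ⟨c, hc⟩ := h
    refine ⟨c, 2 * n + 2, fun B v hB _ => Gives.mono ?_ (const_le_pow hB _)⟩
    rcases hc v with h | h
    · exact ⟨_, rfl, h.mono (by omega)⟩
    · exact h
  induction n with
  | zero => exact ⟨Code.zero', fun v => Or.inl (runs_zero v)⟩
  | succ n ih =>
    obtain ⟨c, hc⟩ := ih
    refine ⟨Code.comp Code.succ c, fun v => Or.inr ?_⟩
    obtain ⟨o, e, r⟩ : Gives c v n (2 * n + 2) := by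
      rcases hc v with h | h
      · exact ⟨_, rfl, h.mono (by omega)⟩
      · exact h
    exact ⟨_, by simp [e], (r.comp (runs_succ o)).mono (by omega)⟩

theorem PolyTime.tail {f : List ℕ → ℕ} (hf : PolyTime f) : PolyTime fun v => f v.tail := by
  obtain ⟨⟨e, he⟩, c, e', h⟩ := hf
  refine ⟨⟨e, fun B v hB hv => he B _ hB fun x hx => hv x (List.mem_of_mem_tail hx)⟩,
    Code.comp c Code.tail, e' + 1, fun B v hB hv => ?_⟩
  refine ((runs_tail v).gives (h B _ hB fun x hx => hv x (List.mem_of_mem_tail hx))).mono ?_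
  have := one_le_pow_of_two_le hB e'
  rw [pow_succ]
  nlinarith

theorem PolyTime.headI : PolyTime List.headI := by
  refine ⟨⟨1, fun B v _ hv => ?_⟩, Code.id, 1, fun B v hB _ => ⟨v, rfl, ?_⟩⟩
  · cases v with
    | nil => simp
    | cons x v => simpa using hv x
  · exact (runs_id v).mono (by simpa using hB)

theorem PolyTime.succ {f : List ℕ → ℕ} (hf : PolyTime f) : PolyTime fun v => f v + 1 := by
  refine ⟨hf.bdd.add (PolyBdd.const 1), ?_⟩
  obtain ⟨_, c, e', h⟩ := hf
  refine ⟨Code.comp Code.succ c, e' + 1, fun B v hB hv => ?_⟩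
  obtain ⟨o, e, r⟩ := h B v hB hv
  refine ⟨_, ?_, (r.comp (runs_succ o)).mono ?_⟩
  · simp [e]
  have := one_le_pow_of_two_le hB e'
  rw [pow_succ]
  nlinarith

/-- Precomposition with a computed first entry in front of the dropped list. -/
theorem PolyTime.cons_drop {f g : List ℕ → ℕ} (hf : PolyTime f) (hg : PolyTime g) (m : ℕ) :
    PolyTime fun v => f (g v :: v.drop m) := by
  obtain ⟨⟨e, he⟩, c, e', h⟩ := hf
  obtain ⟨⟨a, ha⟩, c', a', h'⟩ := hg
  have drp : ∃ k : Code, ∀ v, Runs k v (v.drop m) (m + 2) := by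
    induction m with
    | zero => exact ⟨Code.id, fun v => runs_id v⟩
    | succ m ih =>
      obtain ⟨k, hk⟩ := ih
      refine ⟨Code.comp k Code.tail, fun v => ?_⟩
      have := ((runs_tail v).comp (hk _)).mono (show 1 + (m + 2) ≤ m + 1 + 2 by omega)
      rwa [List.drop_tail] at this
  obtain ⟨k, hk⟩ := drp
  -- The new first entry may exceed `B`, so the bounds for `f` are used with `B ^ (a + 1)` in place
  -- of `B`; exponents multiply.
  have key : ∀ B v, 2 ≤ B → (∀ x ∈ v, x ≤ B) →
      2 ≤ B ^ (a + 1) ∧ ∀ x ∈ g v :: v.drop m, x ≤ B ^ (a + 1) := by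
    intro B v hB hv
    have h1 := one_le_pow_of_two_le hB a
    have h2 : B ≤ B ^ (a + 1) := by rw [pow_succ]; nlinarith
    refine ⟨hB.trans h2, fun x hx => ?_⟩
    rcases List.mem_cons.1 hx with rfl | hx
    · exact (ha B v hB hv).trans (pow_le_pow_of_two_le hB (by omega))
    · exact (hv x (List.mem_of_mem_drop hx)).trans h2
  refine ⟨⟨(a + 1) * e, fun B v hB hv => ?_⟩, Code.comp c (Code.cons c' k),
    (a' + (m + 2) + 1) + (a + 1) * e' + 1, fun B v hB hv => ?_⟩
  · obtain ⟨k1, k2⟩ := key B v hB hv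
    rw [pow_mul]
    exact he _ _ k1 k2
  · obtain ⟨k1, k2⟩ := key B v hB hv
    refine (((h' B v hB hv).cons (hk v)).gives (h _ _ k1 k2)).mono ?_
    rw [← pow_mul]
    exact add_le_pow hB (add_le_pow hB le_rfl (const_le_pow hB _)) le_rfl

/-- The values of a primitive recursion. -/
def primRec (g h : List ℕ → ℕ) (v : List ℕ) : ℕ → ℕ
  | 0 => g v
  | i + 1 => h (i :: primRec g h v i :: v)

/-- A primitive recursion is computed in time polynomial in its arguments, its length and its
intermediate values. -/
theorem PolyTime.primRec_time {g h N : List ℕ → ℕ} (hg : PolyTime g) (hh : PolyTime h)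
    (hN : PolyTime N) : ∃ c e, ∀ B v, 2 ≤ B → (∀ x ∈ v, x ≤ B) → N v ≤ B →
      (∀ i ≤ N v, primRec g h v i ≤ B) → Gives c v (primRec g h v (N v)) (B ^ e) := by
  obtain ⟨_, cg, eg, tg⟩ := hg
  obtain ⟨_, ch, eh, th⟩ := hh
  obtain ⟨_, cN, eN, tN⟩ := hN
  refine ⟨Code.comp Code.tail (Code.comp (Code.fix (loopBody ch))
    (Code.cons cN (Code.cons Code.zero' (Code.cons cg Code.id)))),
    eN + eg + eh + 30,
    fun B v hB hv hNv hr => ?_⟩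
  have r1 := (tN B v hB hv).cons ((Gives.cons ⟨_, rfl, runs_zero v⟩)
    ((tg B v hB hv).cons (runs_id v)))
  have r2 := runs_loop (h := ch) (v := v) (r := primRec g h v) (N := N v) (T := B ^ eh)
    (fun i hi => th B _ hB (by
      intro x hx
      rcases List.mem_cons.1 hx with rfl | hx
      · omega
      rcases List.mem_cons.1 hx with rfl | hx
      · exact hr i hi.le
      · exact hv x hx)) (N v) 0 (by omega)
  refine ⟨_, rfl, ((r1.comp r2).comp (runs_tail _)).mono ?_⟩
  have hB1 : ∀ m, m ≤ B ^ m := const_le_pow hB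
  have t1 : B ^ eN + (1 + (B ^ eg + 2)) ≤ B ^ (eN + eg + 6) :=
    (add_le_pow hB le_rfl (add_le_pow hB (hB1 1) (add_le_pow hB le_rfl (hB1 2)))).trans
      (pow_le_pow_of_two_le hB (by omega))
  have t2 : (N v + 1) * (B ^ eh + 10) ≤ B ^ (eh + 14) :=
    (mul_le_pow (add_le_pow (e := 1) hB (by simpa using hNv) (hB1 1))
      (add_le_pow hB le_rfl (hB1 10))).trans (pow_le_pow_of_two_le hB (by omega))
  exact (add_le_pow hB (add_le_pow hB t1 t2) (hB1 1)).trans (pow_le_pow_of_two_le hB (by omega))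

/-- The a priori bound on all intermediate values is essential: iterating a polynomial-time step can
otherwise leave polynomial growth. -/
theorem PolyTime.primRec {g h N : List ℕ → ℕ} (hg : PolyTime g) (hh : PolyTime h)
    (hN : PolyTime N) {b : List ℕ → ℕ} (hb : PolyBdd b)
    (hr : ∀ v, ∀ i ≤ N v, primRec g h v i ≤ b v) :
    PolyTime fun v => UPT.primRec g h v (N v) := by
  refine ⟨hb.mono fun v => hr v _ le_rfl, ?_⟩
  obtain ⟨c, e, H⟩ := PolyTime.primRec_time hg hh hN
  obtain ⟨eb, heb⟩ := hb
  obtain ⟨eN, heN⟩ := hN.bdd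
  refine ⟨c, (eb + eN + 1) * e, fun B v hB hv => ?_⟩
  rw [pow_mul]
  have h2 : B ≤ B ^ (eb + eN + 1) := Nat.le_self_pow (by omega) B
  exact H _ v (hB.trans h2) (fun x hx => (hv x hx).trans h2)
    ((heN B v hB hv).trans (pow_le_pow_of_two_le hB (by omega)))
    fun i hi => ((hr v i hi).trans (heb B v hB hv)).trans (pow_le_pow_of_two_le hB (by omega))

/-! ### Arithmetic in polynomial time -/

theorem PolyTime.second : PolyTime fun v => v.tail.headI := PolyTime.headI.tail

theorem PolyTime.add {f g : List ℕ → ℕ} (hf : PolyTime f) (hg : PolyTime g) :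
    PolyTime fun v => f v + g v := by
  have e : ∀ v i, UPT.primRec f (fun w => w.tail.headI + 1) v i = f v + i := by
    intro v i
    induction i with
    | zero => rfl
    | succ i ih => simp only [UPT.primRec, List.tail_cons, List.headI_cons, ih, add_assoc]
  simpa only [e] using PolyTime.primRec hf PolyTime.second.succ hg (hf.bdd.add hg.bdd)
    fun v i hi => by rw [e]; omega

theorem PolyTime.mul {f g : List ℕ → ℕ} (hf : PolyTime f) (hg : PolyTime g) :
    PolyTime fun v => f v * g v := by
  have e : ∀ v i, UPT.primRec (fun _ => 0) (fun w => w.tail.headI + f w.tail.tail) v i = f v * i := by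
    intro v i
    induction i with
    | zero => rfl
    | succ i ih => simp only [UPT.primRec, List.tail_cons, List.headI_cons, ih, mul_add, mul_one]
  simpa only [e] using PolyTime.primRec (PolyTime.const 0) (PolyTime.second.add hf.tail.tail) hg
    (hf.bdd.mul hg.bdd) fun v i hi => by rw [e]; exact Nat.mul_le_mul_left _ hi

theorem PolyTime.pow {f : List ℕ → ℕ} (hf : PolyTime f) (m : ℕ) : PolyTime fun v => f v ^ m := by
  induction m with
  | zero => simpa using PolyTime.const 1
  | succ m ih => simpa only [pow_succ] using ih.mul hf

theorem PolyTime.pred {f : List ℕ → ℕ} (hf : PolyTime f) : PolyTime fun v => f v - 1 := by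
  have e : ∀ v i, UPT.primRec (fun _ => 0) (fun w => w.headI) v i = i - 1 := by
    intro v i
    cases i <;> simp [UPT.primRec]
  simpa only [e] using PolyTime.primRec (PolyTime.const 0) PolyTime.headI hf
    hf.bdd fun v i hi => by rw [e]; omega

theorem PolyTime.sub {f g : List ℕ → ℕ} (hf : PolyTime f) (hg : PolyTime g) :
    PolyTime fun v => f v - g v := by
  have e : ∀ v i, UPT.primRec f (fun w => w.tail.headI - 1) v i = f v - i := by
    intro v i
    induction i with
    | zero => rfl
    | succ i ih => simp only [UPT.primRec, List.tail_cons, List.headI_cons, ih, Nat.sub_sub]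
  simpa only [e] using PolyTime.primRec hf PolyTime.second.pred hg hf.bdd
    fun v i hi => by rw [e]; omega

/-- With truncated subtraction, (1 - (p - q)) * (1 - (q - p)) is the indicator of p = q, so the case
distinction becomes arithmetic. -/
theorem PolyTime.ite_eq {p q f g : List ℕ → ℕ} (hp : PolyTime p) (hq : PolyTime q)
    (hf : PolyTime f) (hg : PolyTime g) : PolyTime fun v => if p v = q v then f v else g v := by
  have hd : PolyTime fun v => (1 - (p v - q v)) * (1 - (q v - p v)) :=
    ((PolyTime.const 1).sub (hp.sub hq)).mul ((PolyTime.const 1).sub (hq.sub hp))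
  have e : (fun v => if p v = q v then f v else g v) = fun v =>
      (1 - (p v - q v)) * (1 - (q v - p v)) * f v +
        (1 - (1 - (p v - q v)) * (1 - (q v - p v))) * g v := by
    funext v
    split_ifs with h
    · simp [h]
    · rcases Nat.lt_or_gt_of_ne h with h | h
      · simp [show 1 - (q v - p v) = 0 by omega]
      · simp [show 1 - (p v - q v) = 0 by omega]
  rw [e]
  exact (hd.mul hf).add (((PolyTime.const 1).sub hd).mul hg)

theorem PolyTime.mod {f g : List ℕ → ℕ} (hf : PolyTime f) (hg : PolyTime g) :
    PolyTime fun v => f v % (g v + 1) := by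
  have e : ∀ v i, UPT.primRec (fun _ => 0)
      (fun w => if w.tail.headI = g w.tail.tail then 0 else w.tail.headI + 1) v i =
        i % (g v + 1) := by
    intro v i
    induction i with
    | zero => simp [UPT.primRec]
    | succ i ih =>
      simp only [UPT.primRec, List.tail_cons, List.headI_cons, ih]
      have := Nat.mod_lt i (show 0 < g v + 1 by omega)
      split_ifs with h
      · rw [Nat.add_mod, h]
        rcases Nat.eq_zero_or_pos (g v) with h0 | h0
        · simp [h0]
        · rw [Nat.mod_eq_of_lt (show 1 < g v + 1 by omega), Nat.mod_self]
      · rw [Nat.add_mod, Nat.mod_eq_of_lt (show 1 < g v + 1 by omega),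
          Nat.mod_eq_of_lt (show i % (g v + 1) + 1 < g v + 1 by omega)]
  simpa only [e] using PolyTime.primRec (PolyTime.const 0)
    (PolyTime.ite_eq PolyTime.second hg.tail.tail (PolyTime.const 0) PolyTime.second.succ) hf
    hf.bdd fun v i hi => by rw [e]; exact (Nat.mod_le _ _).trans hi

theorem PolyTime.div {f g : List ℕ → ℕ} (hf : PolyTime f) (hg : PolyTime g) :
    PolyTime fun v => f v / (g v + 1) := by
  have e : ∀ v i, UPT.primRec (fun _ => 0)
      (fun w => w.tail.headI + if (w.headI + 1) % (g w.tail.tail + 1) = 0 then 1 else 0) v i =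
        i / (g v + 1) := by
    intro v i
    induction i with
    | zero => simp [UPT.primRec]
    | succ i ih =>
      simp only [UPT.primRec, List.tail_cons, List.headI_cons, ih, Nat.succ_div,
        Nat.dvd_iff_mod_eq_zero]
  simpa only [e] using PolyTime.primRec (PolyTime.const 0)
    (PolyTime.second.add (PolyTime.ite_eq (PolyTime.mod PolyTime.headI.succ hg.tail.tail)
      (PolyTime.const 0) (PolyTime.const 1) (PolyTime.const 0))) hf
    hf.bdd fun v i hi => by rw [e]; exact (Nat.div_le_self _ _).trans hi

/-- Reducing after every multiplication keeps the intermediate values below the modulus; the power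
itself need not be polynomially bounded. -/
theorem PolyTime.pow_mod {f g h : List ℕ → ℕ} (hf : PolyTime f) (hg : PolyTime g)
    (hh : PolyTime h) : PolyTime fun v => f v ^ g v % (h v + 1) := by
  have e : ∀ v i, UPT.primRec (fun v => 1 % (h v + 1))
      (fun w => (w.tail.headI * f w.tail.tail) % (h w.tail.tail + 1)) v i =
        f v ^ i % (h v + 1) := by
    intro v i
    induction i with
    | zero => simp [UPT.primRec]
    | succ i ih => simp [UPT.primRec, List.tail_cons, List.headI_cons, ih, pow_succ]
  simpa only [e] using PolyTime.primRec ((PolyTime.const 1).mod hh)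
    ((PolyTime.second.mul hf.tail.tail).mod hh.tail.tail) hg
    (hh.bdd.add (PolyBdd.const 1)) fun v i hi => by
      rw [e]; exact (Nat.mod_lt _ (Nat.succ_pos _)).le

/-- Dividing repeatedly avoids forming the possibly huge power. This is how the digits of a
parameter are read off. -/
theorem PolyTime.div_pow {f g h : List ℕ → ℕ} (hf : PolyTime f) (hg : PolyTime g)
    (hh : PolyTime h) : PolyTime fun v => f v / (g v + 1) ^ h v := by
  have e : ∀ v i, UPT.primRec f (fun w => w.tail.headI / (g w.tail.tail + 1)) v i =
        f v / (g v + 1) ^ i := by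
    intro v i
    induction i with
    | zero => simp [UPT.primRec]
    | succ i ih => simp [UPT.primRec, ih, pow_succ, Nat.div_div_eq_div_mul]
  simpa only [e] using PolyTime.primRec hf (PolyTime.second.div hg.tail.tail) hh hf.bdd
    fun v i hi => by rw [e]; exact Nat.div_le_self _ _

theorem PolyTime.sum {f N : List ℕ → ℕ} (hf : PolyTime f) (hN : PolyTime N) :
    PolyTime fun v => ∑ i ∈ Finset.range (N v), f (i :: v) := by
  have e : ∀ v i, UPT.primRec (fun _ => 0)
      (fun w => w.tail.headI + f (w.headI :: w.drop 2)) v i =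
        ∑ i ∈ Finset.range i, f (i :: v) := by
    intro v i
    induction i with
    | zero => simp [UPT.primRec]
    | succ i ih => simp [UPT.primRec, ih, Finset.sum_range_succ]
  obtain ⟨a, ha⟩ := hf.bdd
  obtain ⟨b, hb⟩ := hN.bdd
  have key : PolyBdd fun v => ∑ i ∈ Finset.range (N v), f (i :: v) := by
    refine ⟨b + (b + 1) * a, fun B v hB hv => ?_⟩
    have h2 : B ≤ B ^ (b + 1) := Nat.le_self_pow (by omega) B
    refine (Finset.sum_le_card_nsmul _ _ ((B ^ (b + 1)) ^ a) fun i hi => ?_).trans ?_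
    · refine ha _ _ (hB.trans h2) fun x hx => ?_
      rcases List.mem_cons.1 hx with rfl | hx
      · exact (Finset.mem_range.1 hi).le.trans ((hb B v hB hv).trans
          (pow_le_pow_of_two_le hB (by omega)))
      · exact (hv x hx).trans h2
    · rw [Finset.card_range, smul_eq_mul, ← pow_mul]
      exact mul_le_pow (hb B v hB hv) le_rfl
  simpa only [e] using PolyTime.primRec (PolyTime.const 0)
    (PolyTime.second.add (hf.cons_drop PolyTime.headI 2)) hN key
    fun v i hi => by
      rw [e]; exact Finset.sum_le_sum_of_subset (Finset.range_subset_range.2 hi)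

/-! ### The program that prints the hitting set -/

/-- The weight of `α` at the point with parameter `k`, whose digits in base `Q ^ 3` are triples of
an exponent, a base and a modulus. -/
def expo (Q k t : ℕ) : ℕ :=
  ∑ i ∈ Finset.range k, k / (Q ^ 3) ^ i % Q ^ 3 % Q *
    ((k / (Q ^ 3) ^ i % Q ^ 3 / Q % Q) ^ t % (k / (Q ^ 3) ^ i % Q ^ 3 / Q / Q + 1))

/-- The base of the digits of the parameters. -/
def digitBase (c d n s : ℕ) : ℕ := (s * n * d + 1) ^ c

/-- The `x`-th number that is printed: the code of the entry `(a, b)` of the `j`-th matrix of the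
point with parameter `k`, for `x = ((k * n + j) * (d + 1) + a) * (d + 1) + b`. -/
def printed (c d n s x : ℕ) : ℕ :=
  if x % (d + 1) = x / (d + 1) % (d + 1) + 1 then
    expo (digitBase c d n s) (x / (d + 1) / (d + 1) / n)
      (x / (d + 1) % (d + 1) * n + x / (d + 1) / (d + 1) % n) + 1
  else 0

/-- The number of points. -/
def numPoints (c r d n s : ℕ) : ℕ := (digitBase c d n s ^ r) ^ (Nat.log 2 d + 1)

theorem PolyTime.div' {f g : List ℕ → ℕ} (hf : PolyTime f) (hg : PolyTime g) :
    PolyTime fun v => f v / g v := by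
  have e : (fun v => f v / g v) = fun v => if g v = 0 then 0 else f v / (g v - 1 + 1) := by
    funext v
    split_ifs with h
    · simp [h]
    · rw [Nat.sub_add_cancel (by omega)]
  rw [e]
  exact PolyTime.ite_eq hg (PolyTime.const 0) (PolyTime.const 0) (hf.div hg.pred)

theorem PolyTime.mod' {f g : List ℕ → ℕ} (hf : PolyTime f) (hg : PolyTime g) :
    PolyTime fun v => f v % g v := by
  have e : (fun v => f v % g v) = fun v => if g v = 0 then f v else f v % (g v - 1 + 1) := by
    funext v
    split_ifs with h
    · simp [h]
    · rw [Nat.sub_add_cancel (by omega)]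
  rw [e]
  exact PolyTime.ite_eq hg (PolyTime.const 0) hf (hf.mod hg.pred)

theorem PolyTime.expo {f g h : List ℕ → ℕ} (hf : PolyTime f) (hg : PolyTime g)
    (hh : PolyTime h) (h0 : ∀ v, f v ≠ 0) : PolyTime fun v => UPT.expo (f v) (g v) (h v) := by
  have hQ := hf.tail
  have hd : PolyTime fun w => g w.tail / (f w.tail ^ 3) ^ w.headI % f w.tail ^ 3 := by
    have := (hg.tail.div_pow (hQ.pow 3).pred PolyTime.headI).mod' (hQ.pow 3)
    have e : ∀ w : List ℕ, f w.tail ^ 3 - 1 + 1 = f w.tail ^ 3 := fun w =>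
      Nat.sub_add_cancel (Nat.pos_of_ne_zero (pow_ne_zero _ (h0 _)))
    simpa only [e] using this
  exact PolyTime.sum ((hd.mod' hQ).mul (((hd.div' hQ).mod' hQ).pow_mod hh.tail
    ((hd.div' hQ).div' hQ))) hg

theorem PolyTime.arg (i : ℕ) : PolyTime fun v => (v.drop i).headI := by
  induction i with
  | zero => exact PolyTime.headI
  | succ i ih => simpa only [List.drop_tail] using ih.tail

theorem PolyTime.printed (c : ℕ) : PolyTime fun v =>
    UPT.printed c (v.drop 1).headI (v.drop 2).headI (v.drop 3).headI v.headI := by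
  have hx := PolyTime.headI
  have hd := PolyTime.arg 1
  have hn := PolyTime.arg 2
  have hs := PolyTime.arg 3
  have hQ : PolyTime fun v =>
      digitBase c (v.drop 1).headI (v.drop 2).headI (v.drop 3).headI :=
    ((hs.mul hn).mul hd).succ.pow c
  exact PolyTime.ite_eq (hx.mod hd) ((hx.div hd).mod hd).succ
    (PolyTime.expo hQ (((hx.div hd).div hd).div' hn)
      ((((hx.div hd).mod hd).mul hn).add (((hx.div hd).div hd).mod' hn))
      fun v => pow_ne_zero _ (Nat.succ_ne_zero _)).succ (PolyTime.const 0)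

/-- The number of points is computed by a recursion that multiplies for each binary digit
of `d`. -/
theorem numPoints_eq_primRec (c r : ℕ) (v : List ℕ) (i : ℕ) :
    primRec (fun _ => 1) (fun w => w.tail.headI * if w.tail.tail.headI / (1 + 1) ^ w.headI = 0 then 1 else
      digitBase c w.tail.tail.headI (w.tail.tail.drop 1).headI (w.tail.tail.drop 2).headI ^ r) v i =
    (digitBase c v.headI (v.drop 1).headI (v.drop 2).headI ^ r) ^
      (if v.headI = 0 then 0 else min i (Nat.log 2 v.headI + 1)) := by
  induction i with
  | zero => simp [primRec]
  | succ i ih =>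
    simp only [primRec, List.tail_cons, List.headI_cons, ih]
    by_cases h0 : v.headI = 0
    · simp [h0]
    · have hp : v.headI / (1 + 1) ^ i = 0 ↔ Nat.log 2 v.headI < i := by
        rw [Nat.div_eq_zero_iff, one_add_one_eq_two, Nat.log_lt_iff_lt_pow (by norm_num) h0]
        simp
      by_cases h : i ≤ Nat.log 2 v.headI
      · rw [if_neg h0, if_neg h0, if_neg (by omega), ← pow_succ]
        congr 1
        omega
      · rw [if_neg h0, if_neg h0, if_pos (by omega), mul_one]
        congr 1
        omega

/-! ### The printing loop -/

/-- The body of a loop on states `remaining :: a :: b :: c :: out` that puts numbers in front of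
`out` and finally keeps `out` only. -/
def printBody (p : Code) : Code :=
  Code.case (Code.comp Code.zero' (Code.comp Code.tail (Code.comp Code.tail Code.tail)))
    (Code.cons codeOne (Code.cons Code.id (Code.cons Code.tail
      (Code.cons (Code.comp Code.tail Code.tail)
        (Code.cons (Code.comp Code.tail (Code.comp Code.tail Code.tail))
          (Code.cons p (Code.comp Code.tail
            (Code.comp Code.tail (Code.comp Code.tail Code.tail)))))))))

/-- The counter runs downwards while values are put in front, so the list comes out in increasing
order. The code `p` is called with the numbers printed so far at the end of its argument list. -/
theorem runs_print {p : Code} {f : ℕ → ℕ} {a b c N T : ℕ}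
    (h : ∀ i < N, Gives p (i :: a :: b :: c :: (List.range' (i + 1) (N - (i + 1))).map f) (f i) T) :
    ∀ x ≤ N, Runs (Code.fix (printBody p))
      (x :: a :: b :: c :: (List.range' x (N - x)).map f) ((List.range N).map f)
      ((x + 1) * (T + 20)) := by
  intro x
  induction x with
  | zero =>
    intro _
    refine (Runs.fix_stop (Runs.case_zero (Runs.comp (((runs_tail _).comp
      (runs_tail _)).comp (runs_tail _)) ?_))).mono (show 1 + 1 + 1 + 1 ≤ _ by omega)
    simpa [List.range_eq_range'] using runs_zero ((List.range N).map f)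
  | succ x ih =>
    intro hx
    have r := runs_tail (x :: a :: b :: c :: (List.range' (x + 1) (N - (x + 1))).map f)
    have body : Runs (printBody p) ((x + 1) :: a :: b :: c :: (List.range' (x + 1) (N - (x + 1))).map f)
        (1 :: x :: a :: b :: c :: (List.range' x (N - x)).map f)
        (2 + (2 + (1 + ((1 + 1) + ((1 + 1 + 1) + (T + (1 + 1 + 1 + 1))))))) := by
      have e : (List.range' x (N - x)).map f =
          f x :: (List.range' (x + 1) (N - (x + 1))).map f := by
        obtain ⟨m, hm⟩ : ∃ m, N - x = m + 1 := ⟨N - x - 1, by omega⟩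
        rw [hm, List.range'_succ, show N - (x + 1) = m by omega, List.map_cons]
      rw [e]
      exact Runs.case_succ <| (gives_one _).cons <| (Gives.cons ⟨_, rfl, runs_id _⟩) <|
        (Gives.cons ⟨_, rfl, r⟩) <| (Gives.cons ⟨_, rfl, r.comp (runs_tail _)⟩) <|
        (Gives.cons ⟨_, rfl, (r.comp (runs_tail _)).comp (runs_tail _)⟩) <|
        (h x (by omega)).cons <| (((r.comp (runs_tail _)).comp (runs_tail _)).comp (runs_tail _))
    exact (body.fix_next (ih (by omega))).mono (by nlinarith)

theorem one_le_mul_mul {d n s : ℕ} (hd : 1 ≤ d) (hn : 1 ≤ n) (hs : 1 ≤ s) : 1 ≤ s * n * d :=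
  Nat.mul_pos (Nat.mul_pos hs hn) hd

theorem le_mul_mul {d n s : ℕ} (hd : 1 ≤ d) (hn : 1 ≤ n) (hs : 1 ≤ s) :
    d ≤ s * n * d ∧ n ≤ s * n * d ∧ s ≤ s * n * d :=
  ⟨Nat.le_mul_of_pos_left _ (Nat.mul_pos hs hn),
    (Nat.le_mul_of_pos_left n hs).trans (Nat.le_mul_of_pos_right _ hd),
    (Nat.le_mul_of_pos_right s hn).trans (Nat.le_mul_of_pos_right _ hd)⟩

/-- All the numbers that are printed. -/
def output (c r d n s : ℕ) : List ℕ :=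
  (List.range (numPoints c r d n s * (n * ((d + 1) * (d + 1))))).map (printed c d n s)

/-- The number of points is only quasi-polynomial in the input. All numbers in use are bounded by a
power of one quasi-polynomial `B`, so each polynomial-time subroutine takes time a fixed power of
`B`. -/
theorem exists_program (c r : ℕ) : ∃ (P : Code) (C : ℕ), ∀ d n s : ℕ, 1 ≤ d → 1 ≤ n → 1 ≤ s →
    RunsInTime P [d, n, s] (output c r d n s) ((s * n * d + 1) ^ (C * (Nat.log 2 d + 1))) := by
  have hQ : PolyTime fun w : List ℕ => digitBase c w.tail.tail.headI
      (w.tail.tail.drop 1).headI (w.tail.tail.drop 2).headI ^ r :=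
    ((((PolyTime.arg 2).mul (PolyTime.arg 1)).mul PolyTime.headI).succ.pow c).tail.tail.pow r
  have hM := PolyTime.second.mul (PolyTime.ite_eq
    (PolyTime.div_pow PolyTime.headI.tail.tail (PolyTime.const 1) PolyTime.headI)
    (PolyTime.const 0) (PolyTime.const 1) hQ)
  obtain ⟨cM, eM, tM⟩ := PolyTime.primRec_time (PolyTime.const 1) hM PolyTime.headI
  obtain ⟨⟨a, _⟩, cT, eT, tT⟩ := (PolyTime.arg 0).mul ((PolyTime.arg 2).mul
    ((PolyTime.arg 1).succ.mul (PolyTime.arg 1).succ))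
  obtain ⟨⟨e, he⟩, cp, ep, tp⟩ := PolyTime.printed c
  refine ⟨Code.comp (Code.fix (printBody cp))
    (Code.cons (Code.comp cT (Code.cons cM Code.id)) Code.id),
    -- In the exponent of `B`, `c * r` accounts for the number of points and 3 for the factor
    -- n(d+1)² of entries per point. The second factor collects the running times of the subroutines
    -- in powers of `B`.
    (c * r + 3) * (eM + eT + ((e + 1) * ep) + 100), fun d n s hd hn hs => Runs.runsInTime ?_⟩
  obtain ⟨hd', hn', hs'⟩ := le_mul_mul hd hn hs
  have h1 := one_le_mul_mul hd hn hs
  set b := s * n * d + 1 with hb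
  set B := b ^ ((c * r + 3) * (Nat.log 2 d + 1)) with hB
  have hbB : b ≤ B := Nat.le_self_pow (by positivity) b
  have hB2 : 2 ≤ B := by omega
  have hv : ∀ x ∈ [d, n, s], x ≤ B := by
    simp only [List.mem_cons, List.not_mem_nil, or_false, forall_eq_or_imp, forall_eq]
    omega
  set N := numPoints c r d n s * (n * ((d + 1) * (d + 1))) with hN
  have hM1 : numPoints c r d n s = b ^ (c * r * (Nat.log 2 d + 1)) := by
    rw [numPoints, digitBase, ← hb, ← pow_mul, ← pow_mul, mul_assoc]
  have hMB : numPoints c r d n s ≤ B := by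
    rw [hM1]
    exact Nat.pow_le_pow_right (by omega) (Nat.mul_le_mul_right _ (by omega))
  have hNB : N ≤ B := by
    calc N ≤ b ^ (c * r * (Nat.log 2 d + 1)) * (b * (b * b)) := by
          rw [hN, hM1]
          gcongr <;> omega
      _ = b ^ (c * r * (Nat.log 2 d + 1) + 3) := by ring
      _ ≤ B := Nat.pow_le_pow_right (by omega) (by nlinarith)
  have rM := tM B [d, n, s] hB2 hv (hv d (by simp)) (by
    intro i _
    rw [numPoints_eq_primRec, List.headI_cons, if_neg (by omega)]
    refine le_trans ?_ hMB
    exact Nat.pow_le_pow_right (Nat.pos_of_ne_zero (pow_ne_zero _ (pow_ne_zero _ (Nat.succ_ne_zero _))))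
      (min_le_right _ _))
  have eM' : primRec (fun _ => 1) (fun w => w.tail.headI * if w.tail.tail.headI / (1 + 1) ^ w.headI = 0
      then 1 else digitBase c w.tail.tail.headI (w.tail.tail.drop 1).headI
        (w.tail.tail.drop 2).headI ^ r) [d, n, s] d = numPoints c r d n s := by
    rw [numPoints_eq_primRec, List.headI_cons, if_neg (by omega), min_eq_right]
    · rfl
    · exact Nat.log_lt_self 2 (by omega)
  have rM' : Gives cM [d, n, s] (numPoints c r d n s) (B ^ eM) := eM' ▸ rM
  have rT : Gives cT (numPoints c r d n s :: [d, n, s]) N (B ^ eT) := tT B _ hB2 (by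
    intro x hx
    rcases List.mem_cons.1 hx with rfl | hx
    · exact hMB
    · exact hv x hx)
  have hBe : B ≤ B ^ (e + 1) := Nat.le_self_pow (by omega) B
  have rp : ∀ i < N, Gives cp (i :: d :: n :: s ::
      (List.range' (i + 1) (N - (i + 1))).map (printed c d n s)) (printed c d n s i)
      ((B ^ (e + 1)) ^ ep) := by
    intro i hi
    -- The arguments include the numbers already printed, which are bounded by `B ^ e` only; hence
    -- the larger bound `B ^ (e + 1)`.
    refine tp _ _ (hB2.trans hBe) fun x hx => ?_
    have h4 : ∀ i < N, ∀ x ∈ [i, d, n, s], x ≤ B := fun i hi x hx => by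
      rcases List.mem_cons.1 hx with rfl | hx
      · omega
      · exact hv x hx
    rw [show i :: d :: n :: s :: (List.range' (i + 1) (N - (i + 1))).map (printed c d n s) =
      [i, d, n, s] ++ (List.range' (i + 1) (N - (i + 1))).map (printed c d n s) from rfl,
      List.mem_append] at hx
    rcases hx with hx | hx
    · exact (h4 i hi x hx).trans hBe
    · obtain ⟨j, hj, rfl⟩ := List.mem_map.1 hx
      rw [List.mem_range'_1] at hj
      exact (he B [j, d, n, s] hB2 (h4 j (by omega))).trans
        (pow_le_pow_of_two_le hB2 (by omega))
  have rl := runs_print rp N le_rfl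
  rw [Nat.sub_self] at rl
  refine (((((rM'.cons (runs_id _)).gives rT).cons (runs_id _))).comp rl).mono ?_
  have t1 : B ^ eM + 2 + B ^ eT + 2 ≤ B ^ (eM + eT + 10) :=
    (add_le_pow hB2 (add_le_pow hB2 (add_le_pow hB2 le_rfl (const_le_pow hB2 2)) le_rfl)
      (const_le_pow hB2 2)).trans (pow_le_pow_of_two_le hB2 (by omega))
  have t2 : (N + 1) * ((B ^ (e + 1)) ^ ep + 20) ≤ B ^ ((e + 1) * ep + 30) :=
    (mul_le_pow (add_le_pow (e := 1) hB2 (by simpa using hNB) (const_le_pow hB2 1))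
      (add_le_pow hB2 (by rw [← pow_mul]) (const_le_pow hB2 20))).trans
      (pow_le_pow_of_two_le hB2 (by omega))
  refine (add_le_pow hB2 t1 t2).trans ?_
  rw [hB, ← pow_mul]
  refine Nat.pow_le_pow_right (by omega) ?_
  calc _ ≤ (c * r + 3) * (Nat.log 2 d + 1) * (eM + eT + (e + 1) * ep + 100) :=
        Nat.mul_le_mul_left _ (by omega)
    _ = _ := by ring

end UPT

namespace UPT

/-! ### Isolating weights -/

section Isolation

variable {F : Type*} {d n : ℕ}

/-- The row of the word `m` in the flattening of the tensor `f` that separates the positions in `I`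
from the others. Rows and columns are indexed by full words, of which only a part matters. -/
def row (f : (Fin d → Fin n) → F) (I : Finset (Fin d)) (m : Fin d → Fin n) :
    (Fin d → Fin n) → F :=
  fun m' => f (I.piecewise m m')

theorem row_congr {f : (Fin d → Fin n) → F} {I : Finset (Fin d)} {x y : Fin d → Fin n} (h : ∀ j ∈ I, x j = y j) : row f I x = row f I y := by
  funext m
  unfold row
  congr 1
  funext j
  by_cases hj : j ∈ I
  · simp [hj, h j hj]
  · simp [hj]

variable [Field F]

/-- The rank of the flattening of `f` that separates the positions in `I` from the others. -/
noncomputable def flatRank (f : (Fin d → Fin n) → F) (I : Finset (Fin d)) : ℕ :=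
  (Matrix.of (row f I)).rank

/-- The weight of the part of a word at the positions in `I`. -/
def wt (ω : Fin d → Fin n → ℕ) (I : Finset (Fin d)) (m : Fin d → Fin n) : ℕ :=
  ∑ j ∈ I, ω j (m j)

/-- The weight `ω` isolates the set `S` of words on `I` with respect to `f`: the rows of all other
words are combinations of rows of words in `S` of smaller weight. The words in `S` are constantly
equal to `o` outside `I`. -/
structure Isolates (f : (Fin d → Fin n) → F) (o : Fin n) (ω : Fin d → Fin n → ℕ)
    (I : Finset (Fin d)) (S : Finset (Fin d → Fin n)) : Prop where
  eq_default : ∀ x ∈ S, ∀ j ∉ I, x j = o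
  injOn : Set.InjOn (wt ω I) S
  lower : ∀ m, (∃ x ∈ S, ∀ j ∈ I, x j = m j) ∨
    row f I m ∈ Submodule.span F (row f I '' {x | x ∈ S ∧ wt ω I x < wt ω I m})

/-- A heavier weight with a finer one in its lower digits. -/
def refineWeight (b : ℕ) (ω w : Fin d → Fin n → ℕ) : Fin d → Fin n → ℕ :=
  fun j i => b * ω j i + w j i

variable {f : (Fin d → Fin n) → F} {o : Fin n} {ω w : Fin d → Fin n → ℕ} {b : ℕ}
  {I J : Finset (Fin d)}

theorem wt_refineWeight (m : Fin d → Fin n) :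
    wt (refineWeight b ω w) I m = b * wt ω I m + wt w I m := by
  simp only [wt, refineWeight, Finset.sum_add_distrib, Finset.mul_sum]

theorem wt_congr {x y : Fin d → Fin n} (h : ∀ j ∈ I, x j = y j) : wt ω I x = wt ω I y :=
  Finset.sum_congr rfl fun j hj => by rw [h j hj]

theorem mem_span_image_mono {ι V : Type*} [AddCommGroup V] [Module F V] {v : ι → V} {A B : Set ι}
    {x : V} (hx : x ∈ Submodule.span F (v '' A)) (h : ∀ y ∈ A, y ∈ B) :
    x ∈ Submodule.span F (v '' B) := Submodule.span_mono (Set.image_mono h) hx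

theorem wt_refineWeight_lt {x y : Fin d → Fin n} (hw : ∀ m, wt w I m < b)
    (h : wt ω I x < wt ω I y) : wt (refineWeight b ω w) I x < wt (refineWeight b ω w) I y := by
  rw [wt_refineWeight, wt_refineWeight]
  have := hw x
  nlinarith

theorem wt_refineWeight_eq_iff (hw : ∀ m, wt w I m < b) {x : Fin d → Fin n} {v : ℕ} :
    wt (refineWeight b ω w) I x = v ↔ wt ω I x = v / b ∧ wt w I x = v % b := by
  have hb := hw x
  rw [wt_refineWeight]
  constructor
  · rintro rfl
    constructor
    · rw [Nat.mul_add_div (by omega), Nat.div_eq_of_lt hb, add_zero]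
    · rw [Nat.mul_add_mod, Nat.mod_eq_of_lt hb]
  · rintro ⟨h1, h2⟩
    rw [h1, h2, Nat.div_add_mod]

/-- Finer digits break no strict inequality of the heavier weight. This serves the sets that stay
unchanged at a level where others are merged. -/
theorem Isolates.refine {S : Finset (Fin d → Fin n)} (h : Isolates f o ω I S)
    (hw : ∀ m, wt w I m < b) : Isolates f o (refineWeight b ω w) I S where
  eq_default := h.eq_default
  injOn := fun _ hx y hy e => h.injOn hx hy <|
    ((wt_refineWeight_eq_iff hw).1 e).1.trans ((wt_refineWeight_eq_iff hw (x := y)).1 rfl).1.symm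
  lower := fun m => (h.lower m).imp_right fun hm =>
    mem_span_image_mono hm fun _ hx => ⟨hx.1, wt_refineWeight_lt hw hx.2⟩

theorem wt_union (h : Disjoint I J) (m : Fin d → Fin n) :
    wt ω (I ∪ J) m = wt ω I m + wt ω J m := Finset.sum_union h

theorem wt_union_piecewise (h : Disjoint I J) (x y : Fin d → Fin n) :
    wt ω (I ∪ J) (I.piecewise x y) = wt ω I x + wt ω J y := by
  rw [wt_union h, wt_congr (y := x) fun j hj => Finset.piecewise_eq_of_mem _ _ _ hj,
    wt_congr (I := J) (y := y) fun j hj => Finset.piecewise_eq_of_notMem _ _ _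
      (Finset.disjoint_right.1 h hj)]

/-- The words that are glued from a word on `I` in `S` and a word on the complement in `T`. -/
def glue (I : Finset (Fin d)) (S T : Finset (Fin d → Fin n)) : Finset (Fin d → Fin n) :=
  Finset.image₂ (fun x y => I.piecewise x y) S T

/-- Fixing the letters on `J` is a linear map from rows for `I` to rows for `I ∪ J`, so a linear
relation between rows for `I` persists when the same word is appended on `J`. -/
theorem row_union_mem_left {W : Submodule F ((Fin d → Fin n) → F)} {A : Set (Fin d → Fin n)}
    {m : Fin d → Fin n} (h : row f I m ∈ Submodule.span F (row f I '' A))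
    (hW : ∀ x ∈ A, row f (I ∪ J) (I.piecewise x m) ∈ W) : row f (I ∪ J) m ∈ W := by
  have e : ∀ x, LinearMap.funLeft F F (fun m' => J.piecewise m m') (row f I x) =
      row f (I ∪ J) (I.piecewise x m) := by
    intro x
    funext m'
    simp only [LinearMap.funLeft_apply, row]
    congr 1
    funext j
    by_cases h1 : j ∈ I <;> by_cases h2 : j ∈ J <;> simp [Finset.piecewise, h1, h2]
  have := Submodule.mem_map_of_mem (f := LinearMap.funLeft F F (fun m' => J.piecewise m m')) h
  rw [Submodule.map_span, e, Finset.piecewise_same] at this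
  refine Submodule.span_le.2 ?_ this
  rintro _ ⟨_, ⟨x, hx, rfl⟩, rfl⟩
  rw [e]
  exact hW x hx

theorem row_union_mem_right (hIJ : Disjoint I J) {W : Submodule F ((Fin d → Fin n) → F)}
    {A : Set (Fin d → Fin n)} {x m : Fin d → Fin n}
    (h : row f J m ∈ Submodule.span F (row f J '' A))
    (hW : ∀ y ∈ A, row f (I ∪ J) (I.piecewise x y) ∈ W) :
    row f (I ∪ J) (I.piecewise x m) ∈ W := by
  have e : ∀ y, LinearMap.funLeft F F (fun m' => I.piecewise x m') (row f J y) =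
      row f (I ∪ J) (I.piecewise x y) := by
    intro y
    funext m'
    simp only [LinearMap.funLeft_apply, row]
    congr 1
    funext j
    by_cases h1 : j ∈ I
    · simp [Finset.piecewise, h1, Finset.disjoint_left.1 hIJ h1]
    · by_cases h2 : j ∈ J <;> simp [Finset.piecewise, h1, h2]
  have := Submodule.mem_map_of_mem (f := LinearMap.funLeft F F (fun m' => I.piecewise x m')) h
  rw [Submodule.map_span, e] at this
  refine Submodule.span_le.2 ?_ this
  rintro _ ⟨_, ⟨y, hy, rfl⟩, rfl⟩
  rw [e]
  exact hW y hy

theorem glue_eq_default {S T : Finset (Fin d → Fin n)} (hT : Isolates f o ω J T) : ∀ x ∈ glue I S T, ∀ j ∉ I ∪ J, x j = o := by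
  intro z hz j hj
  obtain ⟨x, hx, y, hy, rfl⟩ := Finset.mem_image₂.1 hz
  rw [Finset.mem_union, not_or] at hj
  rw [Finset.piecewise_eq_of_notMem _ _ _ hj.1]
  exact hT.eq_default y hy j hj.2

/-- If one half of a word is not selected, its row is replaced by strictly lighter rows. The sum of
the `ω`-weights then drops strictly, so the order is decided before `w` matters; `w` only separates
glued words. -/
theorem Isolates.union {S T : Finset (Fin d → Fin n)} (hS : Isolates f o ω I S)
    (hT : Isolates f o ω J T) (hIJ : Disjoint I J) (hw : ∀ m, wt w (I ∪ J) m < b)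
    (hinj : Set.InjOn (wt w (I ∪ J)) (glue I S T)) :
    Isolates f o (refineWeight b ω w) (I ∪ J) (glue I S T) where
  eq_default := glue_eq_default hT
  injOn := fun _ hx y hy e => hinj hx hy <|
    ((wt_refineWeight_eq_iff hw).1 e).2.trans ((wt_refineWeight_eq_iff hw (x := y)).1 rfl).2.symm
  lower := fun m => by
    have mem : ∀ x ∈ S, ∀ y ∈ T, wt ω I x + wt ω J y < wt ω I m + wt ω J m →
        row f (I ∪ J) (I.piecewise x y) ∈ Submodule.span F (row f (I ∪ J) ''
          {z | z ∈ glue I S T ∧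
            wt (refineWeight b ω w) (I ∪ J) z < wt (refineWeight b ω w) (I ∪ J) m}) := by
      intro x hx y hy hlt
      refine Submodule.subset_span ⟨_, ⟨Finset.mem_image₂_of_mem hx hy, ?_⟩, rfl⟩
      refine wt_refineWeight_lt hw ?_
      rwa [wt_union_piecewise hIJ, wt_union hIJ]
    have agree : ∀ x y, (∀ j ∈ J, y j = m j) →
        row f (I ∪ J) (I.piecewise x m) = row f (I ∪ J) (I.piecewise x y) := by
      intro x y h
      refine row_congr fun j hj => ?_
      by_cases hI : j ∈ I
      · simp [hI]
      · simp only [hI, not_false_eq_true, Finset.piecewise_eq_of_notMem]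
        exact (h j ((Finset.mem_union.1 hj).resolve_left hI)).symm
    rcases hS.lower m with ⟨x, hx, ex⟩ | h1
    · rcases hT.lower m with ⟨y, hy, ey⟩ | h2
      · refine Or.inl ⟨_, Finset.mem_image₂_of_mem hx hy, fun j hj => ?_⟩
        by_cases hI : j ∈ I
        · simp [hI, ex j hI]
        · simp only [hI, not_false_eq_true, Finset.piecewise_eq_of_notMem]
          exact ey j ((Finset.mem_union.1 hj).resolve_left hI)
      · right
        have e : row f (I ∪ J) m = row f (I ∪ J) (I.piecewise x m) := by
          refine row_congr fun j hj => ?_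
          by_cases hI : j ∈ I
          · simp [hI, ex j hI]
          · simp [hI]
        rw [e]
        refine row_union_mem_right hIJ h2 fun y hy => mem x hx y hy.1 ?_
        rw [wt_congr ex]
        exact Nat.add_lt_add_left hy.2 _
    · right
      refine row_union_mem_left h1 fun x hx => ?_
      rcases hT.lower m with ⟨y, hy, ey⟩ | h2
      · rw [agree x y ey]
        refine mem x hx.1 y hy ?_
        rw [wt_congr ey]
        exact Nat.add_lt_add_right hx.2 _
      · exact row_union_mem_right hIJ h2 fun y hy => mem x hx.1 y hy.1 (add_lt_add hx.2 hy.2)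

/-- Adding the elements by increasing `μ`, each one strictly enlarges the span. -/
theorem card_le_finrank_span {ι V : Type*} [AddCommGroup V] [Module F V] [FiniteDimensional F V]
    (v : ι → V) (μ : ι → ℕ) (S : Finset ι) (hμ : Set.InjOn μ S)
    (h : ∀ x ∈ S, v x ∉ Submodule.span F (v '' {y | y ∈ S ∧ μ y < μ x})) :
    S.card ≤ Module.finrank F (Submodule.span F (v '' S)) := by
  classical
  induction S using Finset.induction_on_max_value μ with
  | empty => simp
  | insert a S ha hmax ih =>
    have ih' := ih (hμ.mono (by simp)) fun x hx hmem => h x (Finset.mem_insert_of_mem hx)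
      (mem_span_image_mono hmem fun y hy => ⟨Finset.mem_insert_of_mem hy.1, hy.2⟩)
    rw [Finset.card_insert_of_notMem ha]
    refine Nat.succ_le_of_lt (ih'.trans_lt (Submodule.finrank_lt_finrank_of_lt ?_))
    refine lt_of_le_of_ne (Submodule.span_mono (Set.image_mono (by simp))) fun e => ?_
    refine h a (Finset.mem_insert_self _ _) (mem_span_image_mono
      (e ▸ Submodule.subset_span ⟨a, by simp, rfl⟩ : v a ∈ Submodule.span F (v '' S)) fun y hy => ?_)
    refine ⟨Finset.mem_insert_of_mem hy, lt_of_le_of_ne (hmax y hy) fun e => ha ?_⟩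
    rw [← hμ (Finset.mem_insert_of_mem hy) (Finset.mem_insert_self _ _) e]
    exact hy

/-- Greedy basis: only words whose row is not spanned by lighter rows are kept. By induction on the
weight, discarded rows are spanned by lighter kept ones. Pruning stops the squaring of sizes from
level to level. -/
theorem Isolates.prune {S : Finset (Fin d → Fin n)} (h : Isolates f o ω I S) :
    ∃ S', Isolates f o ω I S' ∧ S'.card ≤ flatRank f I := by
  classical
  set S' := S.filter fun x => row f I x ∉
    Submodule.span F (row f I '' {y | y ∈ S ∧ wt ω I y < wt ω I x}) with hS'
  have hsub : S' ⊆ S := Finset.filter_subset _ _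
  have key : ∀ k, ∀ x ∈ S, wt ω I x = k → x ∉ S' → row f I x ∈
      Submodule.span F (row f I '' {y | y ∈ S' ∧ wt ω I y < wt ω I x}) := by
    intro k
    induction k using Nat.strong_induction_on with
    | _ k ih =>
      intro x hx hk hxS'
      have hx' : row f I x ∈ Submodule.span F (row f I '' {y | y ∈ S ∧ wt ω I y < wt ω I x}) := by
        by_contra hc
        exact hxS' (Finset.mem_filter.2 ⟨hx, hc⟩)
      refine Submodule.span_le.2 ?_ hx'
      rintro _ ⟨y, ⟨hy, hlt⟩, rfl⟩
      by_cases hyS' : y ∈ S'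
      · exact Submodule.subset_span ⟨y, ⟨hyS', hlt⟩, rfl⟩
      · exact mem_span_image_mono (ih _ (hk ▸ hlt) y hy rfl hyS')
          fun z hz => ⟨hz.1, hz.2.trans hlt⟩
  refine ⟨S', ⟨fun x hx => h.eq_default x (hsub hx), h.injOn.mono (by exact_mod_cast hsub),
    fun m => ?_⟩, ?_⟩
  · rcases h.lower m with ⟨x, hx, e⟩ | hm
    · by_cases hxS' : x ∈ S'
      · exact Or.inl ⟨x, hxS', e⟩
      · right
        rw [← row_congr e, ← wt_congr e]
        exact key _ x hx rfl hxS'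
    · right
      refine Submodule.span_le.2 ?_ hm
      rintro _ ⟨y, ⟨hy, hlt⟩, rfl⟩
      by_cases hyS' : y ∈ S'
      · exact Submodule.subset_span ⟨y, ⟨hyS', hlt⟩, rfl⟩
      · exact mem_span_image_mono (key _ y hy rfl hyS')
          fun z hz => ⟨hz.1, hz.2.trans hlt⟩
  · refine (card_le_finrank_span (F := F) (row f I) (wt ω I) S' (h.injOn.mono (by exact_mod_cast hsub))
      fun x hx hc => (Finset.mem_filter.1 hx).2 (mem_span_image_mono hc
        fun y hy => ⟨hsub hy.1, hy.2⟩)).trans ?_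
    rw [flatRank, Matrix.rank_eq_finrank_span_row]
    exact Submodule.finrank_mono (Submodule.span_mono (Set.image_subset_range _ _))

/-- The words that are constant on `I` and equal to `o` outside `I`. -/
def constWords (o : Fin n) (I : Finset (Fin d)) : Finset (Fin d → Fin n) :=
  Finset.univ.image fun i => I.piecewise (fun _ => i) fun _ => o

theorem isolates_of_card_le_one (hI : I.card ≤ 1)
    (hinj : Set.InjOn (wt ω I) (constWords o I)) : Isolates f o ω I (constWords o I) where
  eq_default := fun x hx j hj => by
    obtain ⟨i, -, rfl⟩ := Finset.mem_image.1 hx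
    simp [hj]
  injOn := hinj
  lower := fun m => by
    left
    rcases I.eq_empty_or_nonempty with rfl | ⟨a, ha⟩
    · exact ⟨_, Finset.mem_image.2 ⟨o, Finset.mem_univ _, rfl⟩, by simp⟩
    · refine ⟨_, Finset.mem_image.2 ⟨m a, Finset.mem_univ _, rfl⟩, fun j hj => ?_⟩
      rw [Finset.piecewise_eq_of_mem _ _ _ hj, Finset.card_le_one.1 hI a ha j hj]

theorem card_constWords_le (o : Fin n) (I : Finset (Fin d)) : (constWords o I).card ≤ n :=
  Finset.card_image_le.trans (by simp)

/-- Outside `I` all words in `S` contribute the same constant. This is the purpose of the default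
letter `o`: one hash on full words serves all position sets at once. -/
theorem wt_injOn_of_univ {S : Finset (Fin d → Fin n)} (hS : ∀ x ∈ S, ∀ j ∉ I, x j = o)
    (h : Set.InjOn (wt w Finset.univ) S) : Set.InjOn (wt w I) S := by
  intro x hx y hy e
  refine h hx hy ?_
  have s : ∀ z ∈ S, wt w Finset.univ z = wt w I z + ∑ j ∈ Iᶜ, w j o := by
    intro z hz
    rw [wt, ← Finset.sum_add_sum_compl I, wt]
    congr 1
    exact Finset.sum_congr rfl fun j hj => by rw [hS z hz j (Finset.mem_compl.1 hj)]
  rw [s x hx, s y hy, e]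

theorem wt_le_univ (m : Fin d → Fin n) : wt w I m ≤ wt w Finset.univ m :=
  Finset.sum_le_sum_of_subset (Finset.subset_univ I)

/-- An isolating weight leaves a nonzero coefficient. -/
theorem Isolates.exists_sum_ne_zero {S : Finset (Fin d → Fin n)}
    (h : Isolates f o ω Finset.univ S) (hf : f ≠ 0) :
    ∃ v, ∑ m with wt ω Finset.univ m = v, f m ≠ 0 := by
  classical
  -- For the full set of positions rows are constant functions, so a row spanned by rows of words
  -- with zero coefficient gives a zero coefficient.
  have hr : ∀ m m', row f Finset.univ m m' = f m := fun m m' => by simp [row]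
  have zero : ∀ (A : Set (Fin d → Fin n)) m, (∀ x ∈ A, f x = 0) →
      row f Finset.univ m ∈ Submodule.span F (row f Finset.univ '' A) → f m = 0 := by
    intro A m hA hm
    have : row f Finset.univ m ∈ (⊥ : Submodule F ((Fin d → Fin n) → F)) := by
      refine Submodule.span_le.2 ?_ hm
      rintro _ ⟨x, hx, rfl⟩
      exact (Submodule.mem_bot F).2 (funext fun m' => by rw [hr, hA x hx]; rfl)
    rw [Submodule.mem_bot] at this
    rw [← hr m m, this]
    rfl
  have hne : (S.filter fun x => f x ≠ 0).Nonempty := by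
    by_contra hc
    rw [Finset.not_nonempty_iff_eq_empty, Finset.filter_eq_empty_iff] at hc
    refine hf (funext fun m => ?_)
    rcases h.lower m with ⟨x, hx, e⟩ | hm
    · rw [← funext fun j => e j (Finset.mem_univ j)]
      simpa using hc hx
    · exact zero _ m (fun x hx => by simpa using hc hx.1) hm
  -- Another word of the same weight is excluded by injectivity if it lies in `S`; otherwise it is
  -- spanned by lighter words, all with zero coefficient by minimality.
  obtain ⟨x, hx, hmin⟩ := Finset.exists_min_image _ (wt ω Finset.univ) hne
  rw [Finset.mem_filter] at hx
  refine ⟨wt ω Finset.univ x, ?_⟩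
  rw [Finset.sum_eq_single x]
  · exact hx.2
  · intro m hm hmx
    rw [Finset.mem_filter] at hm
    rcases h.lower m with ⟨y, hy, e⟩ | hm'
    · obtain rfl : y = m := funext fun j => e j (Finset.mem_univ j)
      exact absurd (h.injOn hy hx.1 hm.2) hmx
    · refine zero _ m (fun y hy => ?_) hm'
      by_contra hc
      have := hmin y (Finset.mem_filter.2 ⟨hy.1, hc⟩)
      have := hy.2
      omega
  · intro hc
    simp at hc

end Isolation

/-! ### Hashing -/

section Hashing

variable {d n : ℕ}

/-- The hash function with base `k` and modulus `q + 1`, as a weight. -/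
def hashWeight (k q : ℕ) : Fin d → Fin n → ℕ := fun j i => k ^ (j.val * n + i.val) % (q + 1)

theorem mul_add_inj {n a b x y : ℕ} (hx : x < n) (hy : y < n) (h : a * n + x = b * n + y) :
    a = b ∧ x = y := by
  rcases lt_trichotomy a b with hab | rfl | hab
  · nlinarith
  · exact ⟨rfl, by omega⟩
  · nlinarith

open Polynomial in
/-- The polynomial with the monomials of a word, one for each position. -/
noncomputable def wordPoly (p : ℕ) (x : Fin d → Fin n) : (ZMod p)[X] :=
  ∑ j : Fin d, X ^ (j.val * n + (x j).val)

theorem wordPoly_sub_ne_zero {p : ℕ} (hp : 1 < p) {x y : Fin d → Fin n} (h : x ≠ y) :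
    wordPoly p x - wordPoly p y ≠ 0 := by
  have : Fact (1 < p) := ⟨hp⟩
  obtain ⟨a, ha⟩ := Function.ne_iff.1 h
  intro e
  have e' := congrArg (fun P => Polynomial.coeff P ((a : ℕ) * n + (x a : ℕ))) e
  simp only [wordPoly, Polynomial.coeff_sub, Polynomial.finsetSum_coeff, Polynomial.coeff_X_pow,
    Polynomial.coeff_zero] at e'
  rw [Finset.sum_eq_single a, Finset.sum_eq_zero] at e'
  · simp at e'
  · intro j _
    rw [if_neg]
    intro hj
    obtain ⟨h1, h2⟩ := mul_add_inj (x a).isLt (y j).isLt hj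
    obtain rfl := Fin.ext h1
    exact ha (Fin.ext h2)
  · intro j _ hj
    rw [if_neg]
    intro hj'
    exact hj (Fin.ext (mul_add_inj (x a).isLt (x j).isLt hj').1.symm)
  · simp

theorem natDegree_wordPoly_le (p : ℕ) (x : Fin d → Fin n) :
    (wordPoly p x).natDegree ≤ d * n := by
  refine Polynomial.natDegree_sum_le_of_forall_le _ _ fun j _ => ?_
  refine (Polynomial.natDegree_X_pow_le _).trans ?_
  have := (x j).isLt
  have := j.isLt
  nlinarith

/-- Modulo `p` the weight of a word is its polynomial evaluated at `k`. The product of the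
differences over all pairs is nonzero of degree below `p`, so some residue is not a root. -/
theorem exists_hashWeight_injOn {p : ℕ} (hp : p.Prime) (Z : Finset (Fin d → Fin n))
    (hZ : Z.card ^ 2 * (d * n) < p) :
    ∃ k < p, Set.InjOn (wt (hashWeight k (p - 1)) Finset.univ) (Z : Set (Fin d → Fin n)) := by
  have : Fact p.Prime := ⟨hp⟩
  set P : Polynomial (ZMod p) := ∏ z ∈ Z.offDiag, (wordPoly p z.1 - wordPoly p z.2) with hP
  have hP0 : P ≠ 0 := Finset.prod_ne_zero_iff.2 fun z hz =>
    wordPoly_sub_ne_zero hp.one_lt (Finset.mem_offDiag.1 hz).2.2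
  have hdeg : P.natDegree < p := by
    refine (Polynomial.natDegree_prod_le _ _).trans_lt ((Finset.sum_le_card_nsmul _ _ (d * n)
      fun z _ => (Polynomial.natDegree_sub_le _ _).trans
        (max_le (natDegree_wordPoly_le _ _) (natDegree_wordPoly_le _ _))).trans_lt ?_)
    refine lt_of_le_of_lt ?_ hZ
    rw [smul_eq_mul, Finset.offDiag_card, pow_two]
    exact Nat.mul_le_mul_right _ (Nat.sub_le _ _)
  obtain ⟨κ, hκ⟩ : ∃ κ : ZMod p, P.eval κ ≠ 0 := by
    by_contra! hc
    exact hP0 (Polynomial.eq_zero_of_natDegree_lt_card_of_eval_eq_zero P (f := id)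
      Function.injective_id hc (by rwa [ZMod.card]))
  refine ⟨κ.val, ZMod.val_lt κ, fun x hx y hy e => ?_⟩
  by_contra hxy
  rw [hP, Polynomial.eval_prod, Finset.prod_ne_zero_iff] at hκ
  refine hκ (x, y) (Finset.mem_offDiag.2 ⟨hx, hy, hxy⟩) ?_
  have hc : ∀ z : Fin d → Fin n, ((wt (hashWeight κ.val (p - 1)) Finset.univ z : ℕ) : ZMod p) =
      (wordPoly p z).eval κ := by
    intro z
    simp only [wt, hashWeight, wordPoly, Nat.cast_sum, Polynomial.eval_finsetSum,
      Nat.sub_add_cancel hp.one_le, ZMod.natCast_mod, Nat.cast_pow, ZMod.natCast_zmod_val,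
      Polynomial.eval_pow, Polynomial.eval_X]
  rw [Polynomial.eval_sub, ← hc, ← hc, e, sub_self]

theorem wt_hashWeight_le (k q : ℕ) (m : Fin d → Fin n) :
    wt (hashWeight k q) Finset.univ m ≤ d * q := by
  refine (Finset.sum_le_card_nsmul _ _ q fun j _ => Nat.lt_succ_iff.1 (Nat.mod_lt _ (Nat.succ_pos _))).trans ?_
  simp

end Hashing

/-! ### Isolation along a decomposition of the positions -/

/-- A set of positions that is built from sets with at most one element by `ℓ` levels of disjoint
unions, all of which satisfy `G`. -/
inductive Decomp {d : ℕ} (G : Finset (Fin d) → Prop) : ℕ → Finset (Fin d) → Prop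
  | small (ℓ : ℕ) (I : Finset (Fin d)) : I.card ≤ 1 → Decomp G ℓ I
  | union (ℓ : ℕ) (I J : Finset (Fin d)) : Decomp G ℓ I → Decomp G ℓ J → Disjoint I J →
      G (I ∪ J) → Decomp G (ℓ + 1) (I ∪ J)

theorem Decomp.succ {d : ℕ} {G : Finset (Fin d) → Prop} {ℓ : ℕ} {I : Finset (Fin d)}
    (h : Decomp G ℓ I) : Decomp G (ℓ + 1) I := by
  induction h with
  | small ℓ I h => exact .small _ _ h
  | union ℓ I J _ _ hd hG ih1 ih2 => exact .union _ _ _ ih1 ih2 hd hG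

theorem Decomp.mono {d : ℕ} {G : Finset (Fin d) → Prop} {ℓ ℓ' : ℕ} {I : Finset (Fin d)}
    (h : Decomp G ℓ I) (hℓ : ℓ ≤ ℓ') : Decomp G ℓ' I := by
  induction hℓ with
  | refl => exact h
  | step _ ih => exact ih.succ

section Levels

variable {F : Type*} [Field F] {d n : ℕ}

/-- The weight with one hash function for each level; the first one is the finest. -/
def levelWeight (b : ℕ) : List (ℕ × ℕ) → Fin d → Fin n → ℕ
  | [] => fun _ _ => 0
  | p :: ps => refineWeight b (levelWeight b ps) (hashWeight p.1 p.2)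

/-- The hash function with parameters `p` is bounded by `b`, as are its parameters. -/
def HashBound (d n b : ℕ) (p : ℕ × ℕ) : Prop :=
  p.1 < b ∧ p.2 < b ∧ ∀ m : Fin d → Fin n, wt (hashWeight p.1 p.2) Finset.univ m < b

/-- The induction runs over whole families `Φ`, because all sets of a level share one hash. Passing
to the parts at most doubles the family, which keeps `Φ.card * 2 ^ ℓ ≤ M` invariant. -/
theorem exists_levelWeight_isolates (f : (Fin d → Fin n) → F) (o : Fin n) {b M R : ℕ}
    (hR : 1 ≤ R) (hnR : n ≤ R)
    (hash : ∀ Z : Finset (Fin d → Fin n), Z.card ≤ M * R ^ 2 → ∃ p, HashBound d n b p ∧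
      Set.InjOn (wt (hashWeight p.1 p.2) Finset.univ) (Z : Set (Fin d → Fin n)))
    (ℓ : ℕ) : ∀ Φ : Finset (Finset (Fin d)), (∀ I ∈ Φ, Decomp (fun I => flatRank f I ≤ R) ℓ I) →
      Φ.card * 2 ^ ℓ ≤ M → ∃ ps : List (ℕ × ℕ), ps.length = ℓ + 1 ∧ (∀ p ∈ ps, HashBound d n b p) ∧
        ∀ I ∈ Φ, ∃ S, Isolates f o (levelWeight b ps) I S ∧ S.card ≤ R := by
  classical
  induction ℓ with
  | zero =>
    intro Φ hΦ hM
    obtain ⟨p, hp, hinj⟩ := hash (Φ.biUnion (constWords o)) (by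
      refine (Finset.card_biUnion_le_card_mul _ _ n fun I _ => card_constWords_le o I).trans ?_
      have : Φ.card ≤ M := by simpa using hM
      exact Nat.mul_le_mul this (by nlinarith))
    refine ⟨[p], rfl, by simpa using hp, fun I hI => ?_⟩
    have hI1 : I.card ≤ 1 := by
      have := hΦ I hI
      generalize hz : 0 = z at this
      cases this with
      | small _ _ h => exact h
      | union => simp at hz
    have e : levelWeight b [p] = (hashWeight p.1 p.2 : Fin d → Fin n → ℕ) := by
      funext j i
      simp [levelWeight, refineWeight]
    refine ⟨constWords o I, isolates_of_card_le_one hI1 ?_, (card_constWords_le o I).trans hnR⟩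
    rw [e]
    refine wt_injOn_of_univ (o := o) ?_ (hinj.mono fun x hx => ?_)
    · intro x hx j hj
      obtain ⟨i, -, rfl⟩ := Finset.mem_image.1 hx
      simp [hj]
    · exact Finset.mem_coe.2 (Finset.mem_biUnion.2 ⟨I, hI, hx⟩)
  | succ ℓ ih =>
    intro Φ hΦ hM
    -- Sets with at most one element are passed down unchanged, as `J = I`.
    have split : ∀ I : Finset (Fin d), ∃ J J' : Finset (Fin d), I ∈ Φ →
        Decomp (fun I => flatRank f I ≤ R) ℓ J ∧ Decomp (fun I => flatRank f I ≤ R) ℓ J' ∧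
        (J = I ∨ (Disjoint J J' ∧ I = J ∪ J' ∧ flatRank f I ≤ R)) := by
      intro I
      by_cases hI : I ∈ Φ
      · have := hΦ I hI
        generalize hz : ℓ + 1 = z at this
        cases this with
        | small _ _ h => exact ⟨I, I, fun _ => ⟨.small _ _ h, .small _ _ h, Or.inl rfl⟩⟩
        | union ℓ' J J' h1 h2 hd hG =>
          obtain rfl : ℓ = ℓ' := by omega
          exact ⟨J, J', fun _ => ⟨h1, h2, Or.inr ⟨hd, rfl, hG⟩⟩⟩
      · exact ⟨I, I, fun h => absurd h hI⟩
    choose J J' hJ using split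
    obtain ⟨ps, hlen, hps, hS⟩ := ih (Φ.biUnion fun I => {J I, J' I}) (by
      intro K hK
      obtain ⟨I, hI, hK⟩ := Finset.mem_biUnion.1 hK
      rw [Finset.mem_insert, Finset.mem_singleton] at hK
      rcases hK with rfl | rfl
      · exact (hJ I hI).1
      · exact (hJ I hI).2.1) (by
      have : (Φ.biUnion fun I => {J I, J' I}).card ≤ Φ.card * 2 :=
        Finset.card_biUnion_le_card_mul _ _ 2 fun I _ => Finset.card_le_two
      rw [pow_succ] at hM
      have h2 := Nat.mul_le_mul_right (2 ^ ℓ) this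
      nlinarith)
    have hS' : ∀ K : Finset (Fin d), ∃ S, (∃ I ∈ Φ, K = J I ∨ K = J' I) →
        Isolates f o (levelWeight b ps) K S ∧ S.card ≤ R := by
      intro K
      by_cases hK : ∃ I ∈ Φ, K = J I ∨ K = J' I
      · obtain ⟨I, hI, h⟩ := hK
        obtain ⟨S, hS⟩ := hS K (Finset.mem_biUnion.2 ⟨I, hI, by simpa using h⟩)
        exact ⟨S, fun _ => hS⟩
      · exact ⟨∅, fun h => absurd h hK⟩
    choose S hS using hS'
    obtain ⟨p, hp, hinj⟩ := hash (Φ.biUnion fun I => glue (J I) (S (J I)) (S (J' I))) (by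
      refine (Finset.card_biUnion_le_card_mul _ _ (R ^ 2) fun I hI => ?_).trans ?_
      · refine Finset.card_image₂_le _ _ _ |>.trans ?_
        rw [pow_two]
        exact Nat.mul_le_mul (hS _ ⟨I, hI, Or.inl rfl⟩).2 (hS _ ⟨I, hI, Or.inr rfl⟩).2
      · refine Nat.mul_le_mul_right _ ?_
        exact (Nat.le_mul_of_pos_right _ (by positivity)).trans hM)
    refine ⟨p :: ps, by simp [hlen], ?_, fun I hI => ?_⟩
    · intro p' hp'
      rcases List.mem_cons.1 hp' with rfl | h
      · exact hp
      · exact hps p' h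
    obtain ⟨-, -, h⟩ := hJ I hI
    obtain ⟨h1, c1⟩ := hS _ ⟨I, hI, Or.inl rfl⟩
    obtain ⟨h2, c2⟩ := hS _ ⟨I, hI, Or.inr rfl⟩
    have hb : ∀ m, wt (hashWeight p.1 p.2) I m < b := fun m => (wt_le_univ m).trans_lt (hp.2.2 m)
    rcases h with h | ⟨hdis, h, hG⟩
    · rw [h] at h1 c1
      exact ⟨_, h1.refine hb, c1⟩
    · have hu := h1.union h2 hdis (by rw [← h]; exact hb) (wt_injOn_of_univ (glue_eq_default h2)
        (hinj.mono fun x hx => Finset.mem_coe.2 (Finset.mem_biUnion.2 ⟨I, hI, hx⟩)))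
      rw [← h] at hu
      obtain ⟨T, hT, cT⟩ := hu.prune
      exact ⟨T, hT, cT.trans hG⟩

/-! ### Small exponents: one power of `α` for each level -/

/-- The exponent of the parameter at a variable, where each level has an exponent and the two
parameters of a hash function. -/
def expWeight : List (ℕ × ℕ × ℕ) → Fin d → Fin n → ℕ
  | [] => fun _ _ => 0
  | t :: ts => fun j i => t.1 * hashWeight t.2.1 t.2.2 j i + expWeight ts j i

open Polynomial in
theorem exists_pow_eval_ne_zero {K : Type*} [Field K] {α : K} {b : ℕ}
    (hα : ∀ i j : ℕ, i < b → j < b → α ^ i = α ^ j → i = j) {P : K[X]} (hP : P ≠ 0)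
    (hdeg : P.natDegree < b) : ∃ e < b, P.eval (α ^ e) ≠ 0 := by
  by_contra! hc
  refine hP (Polynomial.eq_zero_of_natDegree_lt_card_of_eval_eq_zero P
    (f := fun i : Fin b => α ^ (i : ℕ)) (fun i j h => Fin.ext (hα _ _ i.isLt j.isLt h))
    (fun i => hc i i.isLt) (by simpa using hdeg))

/-- The digits of `v` in base `b` prescribe the hash weight at each level. Summing out one level
gives a univariate polynomial of degree below `b` whose coefficient at that digit is nonzero, so
some α^e with e < b is not a root. -/
theorem exists_expWeight {K : Type*} [Field K] {α : K} {b : ℕ}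
    (hα : ∀ i j : ℕ, i < b → j < b → α ^ i = α ^ j → i = j) (ps : List (ℕ × ℕ))
    (hps : ∀ p ∈ ps, HashBound d n b p) : ∀ (g : (Fin d → Fin n) → K) (v : ℕ),
    ∑ m with wt (levelWeight b ps) Finset.univ m = v, g m ≠ 0 →
    ∃ ts : List (ℕ × ℕ × ℕ), ts.length = ps.length ∧ (∀ t ∈ ts, t.1 < b ∧ t.2.1 < b ∧ t.2.2 < b) ∧
      ∑ m, g m * α ^ wt (expWeight ts) Finset.univ m ≠ 0 := by
  induction ps with
  | nil =>
    intro g v h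
    refine ⟨[], rfl, by simp, ?_⟩
    by_cases hv : v = 0
    · simpa [wt, levelWeight, expWeight, hv] using h
    · simp [wt, levelWeight, Ne.symm hv] at h
  | cons p ps ih =>
    intro g v h
    have hp := hps p (by simp)
    obtain ⟨ts, hlen, hts, hne⟩ := ih (fun p' h' => hps p' (by simp [h']))
      (fun m => if wt (hashWeight p.1 p.2) Finset.univ m = v % b then g m else 0) (v / b) (by
        rw [← Finset.sum_filter, Finset.filter_filter]
        simpa only [levelWeight, wt_refineWeight_eq_iff hp.2.2] using h)
    set P : Polynomial K := ∑ m, Polynomial.monomial (wt (hashWeight p.1 p.2) Finset.univ m)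
      (g m * α ^ wt (expWeight ts) Finset.univ m) with hP
    have hP0 : P ≠ 0 := by
      intro e
      apply hne
      have := congrArg (fun P => Polynomial.coeff P (v % b)) e
      simp only [hP, Polynomial.finsetSum_coeff, Polynomial.coeff_monomial,
        Polynomial.coeff_zero] at this
      simpa only [ite_mul, zero_mul] using this
    have hb : 0 < b := by have := hp.1; omega
    have hdeg : P.natDegree < b := by
      refine Nat.lt_of_le_pred hb (Polynomial.natDegree_sum_le_of_forall_le _ _ fun m _ => ?_)
      exact (Polynomial.natDegree_monomial_le _).trans (Nat.le_pred_of_lt (hp.2.2 m))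
    obtain ⟨e, he, hev⟩ := exists_pow_eval_ne_zero hα hP0 hdeg
    refine ⟨(e, p.1, p.2) :: ts, by simp [hlen], ?_, ?_⟩
    · intro t ht
      rcases List.mem_cons.1 ht with rfl | ht
      · exact ⟨he, hp.1, hp.2.1⟩
      · exact hts t ht
    · convert hev using 1
      rw [hP, Polynomial.eval_finsetSum]
      refine Finset.sum_congr rfl fun m _ => ?_
      rw [Polynomial.eval_monomial, mul_assoc, ← pow_mul, ← pow_add]
      congr 2
      simp only [wt, expWeight, Finset.sum_add_distrib, Finset.mul_sum]
      rw [add_comm]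

end Levels

/-! ### Balanced decompositions of trees -/

section Trees

variable {d : ℕ}

/-- A set of positions that is built by disjoint unions from sets with at most one element, such that
`G` holds for all sets that occur. -/
inductive PosTree (G : Finset (Fin d) → Prop) : Finset (Fin d) → Prop
  | leaf (I : Finset (Fin d)) : I.card ≤ 1 → G I → PosTree G I
  | node (I J : Finset (Fin d)) : PosTree G I → PosTree G J → Disjoint I J → G (I ∪ J) →
      PosTree G (I ∪ J)

/-- `Below G I K`: there is a tree for `I` in which `K` occurs. -/
inductive Below (G : Finset (Fin d) → Prop) : Finset (Fin d) → Finset (Fin d) → Prop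
  | refl (I : Finset (Fin d)) : PosTree G I → Below G I I
  | node (I J K : Finset (Fin d)) : Below G I K → PosTree G J → Disjoint I J → G (I ∪ J) →
      Below G (I ∪ J) K

variable {G D : Finset (Fin d) → Prop} {I K : Finset (Fin d)}

theorem PosTree.good (h : PosTree G I) : G I := by
  cases h <;> assumption

theorem Below.posTree (h : Below G I K) : PosTree G I ∧ PosTree G K := by
  induction h with
  | refl I h => exact ⟨h, h⟩
  | node I J K _ hJ hd hG ih => exact ⟨.node I J ih.1 hJ hd hG, ih.2⟩

theorem Below.subset (h : Below G I K) : K ⊆ I := by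
  induction h with
  | refl I h => exact subset_rfl
  | node I J K _ _ _ _ ih => exact ih.trans Finset.subset_union_left

/-- Descend into a child with more than `t` positions as long as there is one. `1 ≤ t` excludes
ending at a leaf. -/
theorem PosTree.exists_separator (h : PosTree G I) {t : ℕ} (ht : 1 ≤ t) (hI : t < I.card) :
    ∃ A B, PosTree G A ∧ PosTree G B ∧ Disjoint A B ∧ Below G I (A ∪ B) ∧
      A.card ≤ t ∧ B.card ≤ t ∧ t < (A ∪ B).card := by
  induction h with
  | leaf I h => omega
  | node I J hI' hJ' hd hG ih1 ih2 =>
    by_cases h1 : t < I.card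
    · obtain ⟨A, B, hA, hB, hAB, hb, h⟩ := ih1 h1
      exact ⟨A, B, hA, hB, hAB, .node I J _ hb hJ' hd hG, h⟩
    by_cases h2 : t < J.card
    · obtain ⟨A, B, hA, hB, hAB, hb, h⟩ := ih2 h2
      rw [Finset.union_comm] at hG ⊢
      exact ⟨A, B, hA, hB, hAB, .node J I _ hb hI' hd.symm hG, h⟩
    exact ⟨I, J, hI', hJ', hd, .refl _ (.node I J hI' hJ' hd hG), by omega, by omega, hI⟩

/-- Descend along the path towards the hole `K` only. The side branch `B` may therefore be large,
but it is a full tree without a hole. -/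
theorem Below.exists_separator (h : Below G I K) {t : ℕ} (hI : t < (I \ K).card) :
    ∃ A B, Below G A K ∧ PosTree G B ∧ Disjoint A B ∧ Below G I (A ∪ B) ∧
      (A \ K).card ≤ t ∧ t < ((A ∪ B) \ K).card := by
  induction h with
  | refl I h => simp at hI
  | node I J K hI' hJ' hd hG ih =>
    by_cases h1 : t < (I \ K).card
    · obtain ⟨A, B, hA, hB, hAB, hb, h⟩ := ih h1
      exact ⟨A, B, hA, hB, hAB, .node I J _ hb hJ' hd hG, h⟩
    exact ⟨I, J, hI', hJ', hd, .refl _ (.node I J hI'.posTree.1 hJ' hd hG), by omega, hI⟩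

theorem Below.sdiff_union (h : Below G I K) : (I \ K) ∪ K = I :=
  Finset.sdiff_union_of_subset h.subset

/-- Cutting a subtree out of a tree leaves a tree with a hole, so both kinds are treated together.
Doubling the size costs at most four levels. -/
theorem decomp_of_tree (hG : ∀ I, G I → D I) (hD : ∀ I K, K ⊆ I → G I → G K → D (I \ K)) (k : ℕ) :
    (∀ I, PosTree G I → I.card ≤ 2 ^ k → Decomp D (4 * k) I) ∧
      ∀ I K, Below G I K → (I \ K).card ≤ 2 ^ k → Decomp D (4 * k + 2) (I \ K) := by
  induction k with
  | zero => exact ⟨fun I _ h => .small _ _ h, fun I K _ h => .small _ _ h⟩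
  | succ k ih =>
    have first : ∀ I, PosTree G I → I.card ≤ 2 ^ (k + 1) → Decomp D (4 * (k + 1)) I := by
      intro I hI hc
      by_cases hk : I.card ≤ 2 ^ k
      · exact (ih.1 I hI hk).mono (by omega)
      obtain ⟨A, B, hA, hB, hAB, hb, cA, cB, cAB⟩ := hI.exists_separator Nat.one_le_two_pow
        (not_le.1 hk)
      have hcard := Finset.card_sdiff_add_card_eq_card hb.subset
      have d1 := ih.2 _ _ hb (by rw [pow_succ] at hc; omega)
      have d2 : Decomp D (4 * k + 1) (A ∪ B) :=
        .union _ _ _ (ih.1 A hA cA) (ih.1 B hB cB) hAB (hG _ hb.posTree.2.good)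
      have := Decomp.union _ _ _ d1 (d2.mono (by omega)) Finset.sdiff_disjoint
        (by rw [hb.sdiff_union]; exact hG _ hI.good)
      rw [hb.sdiff_union] at this
      exact this.mono (by omega)
    refine ⟨first, fun I K h hc => ?_⟩
    by_cases hk : (I \ K).card ≤ 2 ^ k
    · exact (ih.2 I K h hk).mono (by omega)
    obtain ⟨A, B, hA, hB, hAB, hb, cA, cAB⟩ := h.exists_separator (not_le.1 hk)
    have hKA := hA.subset
    have hBK : Disjoint B K := Finset.disjoint_of_subset_right hKA hAB.symm
    have e1 : (A ∪ B) \ K = (A \ K) ∪ B := by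
      rw [Finset.union_sdiff_distrib, Finset.sdiff_eq_self_of_disjoint hBK]
    have e2 : I \ K = (I \ (A ∪ B)) ∪ ((A ∪ B) \ K) := by
      ext j
      have := @hKA j
      have : j ∈ A ∪ B → j ∈ I := fun h => hb.subset h
      simp only [Finset.mem_sdiff, Finset.mem_union] at *
      tauto
    have dis : Disjoint (I \ (A ∪ B)) ((A ∪ B) \ K) :=
      Finset.disjoint_of_subset_right Finset.sdiff_subset Finset.sdiff_disjoint
    have hcard := congrArg Finset.card e2
    rw [Finset.card_union_of_disjoint dis] at hcard
    have d1 := ih.2 _ _ hb (by rw [pow_succ] at hc; omega)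
    -- Only `B` may have more than `2 ^ k` positions. It has no hole, so the first half of the
    -- claim, just proved for `k + 1`, gives `4 * k + 4`; two unions make `4 * (k + 1) + 2`.
    have d2 := ih.2 _ _ hA cA
    have d3 := first B hB (le_trans (Finset.card_le_card (by
      rw [e2, e1]
      exact Finset.subset_union_right.trans Finset.subset_union_right)) hc)
    have d4 : Decomp D (4 * k + 5) ((A ∪ B) \ K) := by
      have := hD _ K (hKA.trans Finset.subset_union_left) hb.posTree.2.good hA.posTree.2.good
      rw [e1] at this ⊢
      exact .union _ _ _ (d2.mono (by omega)) (d3.mono (by omega))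
        (Finset.disjoint_of_subset_left Finset.sdiff_subset hAB) this
    have := hD I K h.subset h.posTree.1.good h.posTree.2.good
    rw [e2] at this ⊢
    exact Decomp.union (4 * k + 5) _ _ (d1.mono (by omega)) d4 dis this

end Trees

/-! ### Ranks of flattenings -/

section Rank

variable {F : Type*} [Field F] {d n : ℕ} {f : (Fin d → Fin n) → F} {I J K : Finset (Fin d)}

theorem flatRank_le_card {ι : Type*} (X : Finset ι) (P Q : ι → (Fin d → Fin n) → F)
    (h : ∀ m m', f (I.piecewise m m') = ∑ x ∈ X, P x m * Q x m') : flatRank f I ≤ X.card := by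
  have e : Matrix.of (row f I) = (Matrix.of fun m (x : X) => P x m) *
      (Matrix.of fun (x : X) m' => Q x m') := by
    ext m m'
    rw [Matrix.of_apply, row, h, Matrix.mul_apply, ← Finset.sum_coe_sort]
    rfl
  rw [flatRank, e]
  refine (Matrix.rank_mul_le_left _ _).trans ((Matrix.rank_le_card_width _).trans ?_)
  simp

theorem exists_row_span (f : (Fin d → Fin n) → F) (I : Finset (Fin d)) :
    ∃ S : Finset (Fin d → Fin n), S.card ≤ flatRank f I ∧
      ∀ m, row f I m ∈ Submodule.span F (row f I '' S) := by
  classical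
  obtain ⟨v, hv, hs, -⟩ := Submodule.exists_fun_fin_finrank_span_eq F (Set.range (row f I))
  choose g hg using hv
  refine ⟨Finset.univ.image g, ?_, fun m => ?_⟩
  · refine Finset.card_image_le.trans ?_
    rw [Finset.card_univ, Fintype.card_fin, flatRank, Matrix.rank_eq_finrank_span_row]
    rfl
  · have : row f I m ∈ Submodule.span F (Set.range v) := by
      rw [hs]
      exact Submodule.subset_span ⟨m, rfl⟩
    refine Submodule.span_mono ?_ this
    rintro _ ⟨i, rfl⟩
    exact ⟨g i, by simp, hg i⟩

/-- Glued spanning rows span: expand the part on `I`, then the part on `J`. -/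
theorem flatRank_union_le (h : Disjoint I J) :
    flatRank f (I ∪ J) ≤ flatRank f I * flatRank f J := by
  classical
  obtain ⟨S, hS, sS⟩ := exists_row_span f I
  obtain ⟨T, hT, sT⟩ := exists_row_span f J
  have key : Submodule.span F (Set.range (row f (I ∪ J))) ≤
      Submodule.span F ((glue I S T).image (row f (I ∪ J)) : Set ((Fin d → Fin n) → F)) := by
    refine Submodule.span_le.2 ?_
    rintro _ ⟨m, rfl⟩
    refine row_union_mem_left (sS m) fun x hx => row_union_mem_right h (sT m) fun y hy =>
      Submodule.subset_span ?_
    rw [Finset.coe_image]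
    exact ⟨_, Finset.mem_coe.2 (Finset.mem_image₂_of_mem hx hy), rfl⟩
  rw [flatRank, Matrix.rank_eq_finrank_span_row]
  refine (Submodule.finrank_mono key).trans ((finrank_span_finset_le_card _).trans
    (Finset.card_image_le.trans ((Finset.card_image₂_le _ _ _).trans (Nat.mul_le_mul hS hT))))

theorem flatRank_compl : flatRank f Iᶜ = flatRank f I := by
  rw [flatRank, ← Matrix.rank_transpose, flatRank]
  congr 1
  ext m m'
  simp only [Matrix.transpose_apply, Matrix.of_apply, row]
  congr 1
  funext j
  by_cases hj : j ∈ I <;> simp [hj]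

/-- The complement of `I \ K` is the disjoint union of `Iᶜ` and `K`, and complements have the same
rank. -/
theorem flatRank_sdiff_le (h : K ⊆ I) : flatRank f (I \ K) ≤ flatRank f I * flatRank f K := by
  have e : (I \ K)ᶜ = Iᶜ ∪ K := by
    ext j
    have := @h j
    simp only [Finset.mem_compl, Finset.mem_sdiff, Finset.mem_union]
    tauto
  rw [← flatRank_compl, e, ← flatRank_compl (I := I)]
  exact flatRank_union_le (Finset.disjoint_left.2 fun j hj hK => Finset.mem_compl.1 hj (h hK))

end Rank

/-! ### Coefficients of non-commutative polynomials -/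

section Coefficients

variable {F : Type*} [Field F] {n : ℕ}

/-- The coefficient of a word. -/
noncomputable def coef (w : List (Fin n)) : FreeAlgebra F (Fin n) →ₗ[F] F where
  toFun p := (FreeAlgebra.equivMonoidAlgebraFreeMonoid p).coeff (FreeMonoid.ofList w)
  map_add' p q := by simp
  map_smul' c p := by simp

/-- The monomial of a word. -/
def word (F : Type*) [Field F] (w : List (Fin n)) : FreeAlgebra F (Fin n) :=
  (w.map (FreeAlgebra.ι F)).prod

theorem equiv_word (w : List (Fin n)) : FreeAlgebra.equivMonoidAlgebraFreeMonoid (word F w) =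
    MonoidAlgebra.single (FreeMonoid.ofList w) 1 := by
  induction w with
  | nil =>
    simp only [word, List.map_nil, List.prod_nil, map_one]
    rfl
  | cons i w ih =>
    have e : word F (i :: w) = FreeAlgebra.ι F i * word F w := by simp [word]
    rw [e, map_mul, ih]
    simp [FreeAlgebra.equivMonoidAlgebraFreeMonoid, MonoidAlgebra.single_mul_single]

theorem coef_word (u w : List (Fin n)) : coef u (word F w) = if w = u then 1 else 0 := by
  classical
  change (FreeAlgebra.equivMonoidAlgebraFreeMonoid (word F w)).coeff (FreeMonoid.ofList u) = _
  rw [equiv_word]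
  simp [Finsupp.single_apply]

theorem word_append (u w : List (Fin n)) : word F (u ++ w) = word F u * word F w := by
  simp [word]

theorem exists_coef_ne_zero {p : FreeAlgebra F (Fin n)} (hp : p ≠ 0) : ∃ w, coef w p ≠ 0 := by
  by_contra! hc
  refine hp (FreeAlgebra.equivMonoidAlgebraFreeMonoid.injective ?_)
  rw [map_zero]
  exact MonoidAlgebra.ext (Finsupp.ext fun w => hc (FreeMonoid.toList w))

theorem homogeneous_induction {d : ℕ} {P : FreeAlgebra F (Fin n) → Prop}
    (word : ∀ w : List (Fin n), w.length = d → P (word F w)) (zero : P 0)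
    (add : ∀ p q, P p → P q → P (p + q)) (smul : ∀ (c : F) p, P p → P (c • p))
    {p : FreeAlgebra F (Fin n)} (hp : p ∈ homogeneous F n d) : P p := by
  induction hp using Submodule.span_induction with
  | mem x h =>
    obtain ⟨w, hw, rfl⟩ := h
    exact word w hw
  | zero => exact zero
  | add x y _ _ hx hy => exact add x y hx hy
  | smul c x _ hx => exact smul c x hx

theorem word_mem (w : List (Fin n)) : word F w ∈ homogeneous F n w.length :=
  Submodule.subset_span ⟨w, rfl, rfl⟩

theorem one_mem_homogeneous : (1 : FreeAlgebra F (Fin n)) ∈ homogeneous F n 0 :=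
  word_mem (F := F) ([] : List (Fin n))

theorem ι_mem_homogeneous (i : Fin n) : FreeAlgebra.ι F i ∈ homogeneous F n 1 := by
  simpa [word] using word_mem (F := F) [i]

theorem homogeneous_mul_le (a b : ℕ) :
    homogeneous F n a * homogeneous F n b ≤ homogeneous F n (a + b) := by
  rw [homogeneous, homogeneous, Submodule.span_mul_span, Submodule.span_le]
  rintro _ ⟨_, ⟨u, rfl, rfl⟩, _, ⟨w, rfl, rfl⟩, rfl⟩
  exact Submodule.subset_span ⟨u ++ w, by simp, by simp⟩

theorem mul_mem_homogeneous {a b : ℕ} {p q : FreeAlgebra F (Fin n)}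
    (hp : p ∈ homogeneous F n a) (hq : q ∈ homogeneous F n b) :
    p * q ∈ homogeneous F n (a + b) :=
  homogeneous_mul_le a b (Submodule.mul_mem_mul hp hq)

theorem length_eq_of_coef_ne_zero {d : ℕ} {p : FreeAlgebra F (Fin n)}
    (hp : p ∈ homogeneous F n d) {w : List (Fin n)} (hw : coef w p ≠ 0) : w.length = d := by
  by_contra hc
  refine hw ?_
  refine homogeneous_induction (P := fun p => coef w p = 0) (fun u hu => ?_) (map_zero _)
    (fun p q hp hq => ?_) (fun c p hp => ?_) hp
  · rw [coef_word, if_neg]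
    rintro rfl
    exact hc hu
  · rw [map_add, hp, hq, add_zero]
  · rw [map_smul, hp, smul_zero]

theorem coef_append_mul {p q : FreeAlgebra F (Fin n)} {u w : List (Fin n)}
    (hp : p ∈ homogeneous F n u.length) (hq : q ∈ homogeneous F n w.length) :
    coef (u ++ w) (p * q) = coef u p * coef w q := by
  refine homogeneous_induction (P := fun p => coef (u ++ w) (p * q) = coef u p * coef w q)
    (fun u' hu => ?_) (by simp) (fun p p' h h' => ?_) (fun c p h => ?_) hp
  · refine homogeneous_induction (P := fun q => coef (u ++ w) (word F u' * q) =
      coef u (word F u') * coef w q) (fun w' hw => ?_) (by simp) (fun q q' h h' => ?_)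
      (fun c q h => ?_) hq
    · rw [← word_append, coef_word, coef_word, coef_word]
      by_cases h1 : u' = u
      · by_cases h2 : w' = w <;> simp [h1, h2]
      · rw [if_neg fun e => h1 (List.append_inj_left e hu), if_neg h1, zero_mul]
    · rw [mul_add, map_add, h, h', map_add, mul_add]
    · rw [mul_smul_comm, map_smul, h, map_smul, smul_eq_mul, smul_eq_mul, mul_left_comm]
  · rw [add_mul, map_add, h, h', map_add, add_mul]
  · rw [smul_mul_assoc, map_smul, h, map_smul, smul_eq_mul, smul_eq_mul, mul_assoc]

/-- The coefficients of the words of length `d`. -/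
noncomputable def tensor (d : ℕ) (p : FreeAlgebra F (Fin n)) (m : Fin d → Fin n) : F :=
  coef (List.ofFn m) p

/-- The `δ` positions from `a` on. -/
def interval (d a δ : ℕ) : Finset (Fin d) := Finset.univ.filter fun j => a ≤ j.val ∧ j.val < a + δ

theorem interval_add (d a δ δ' : ℕ) :
    interval d a (δ + δ') = interval d a δ ∪ interval d (a + δ) δ' := by
  ext j
  simp only [interval, Finset.mem_filter, Finset.mem_univ, true_and, Finset.mem_union]
  omega

theorem disjoint_interval (d a δ δ' : ℕ) :
    Disjoint (interval d a δ) (interval d (a + δ) δ') := by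
  refine Finset.disjoint_left.2 fun j h h' => ?_
  simp only [interval, Finset.mem_filter, Finset.mem_univ, true_and] at h h'
  omega

theorem card_interval_le_one {d a δ : ℕ} (hδ : δ ≤ 1) : (interval d a δ).card ≤ 1 := by
  refine Finset.card_le_one.2 fun i hi j hj => Fin.ext ?_
  simp only [interval, Finset.mem_filter, Finset.mem_univ, true_and] at hi hj
  omega

/-- By homogeneity the coefficient of a word in p·x·q is the product of the coefficients of its
three segments. Only the middle factor sees the interval, so each `x` contributes rank one. -/
theorem flatRank_interval_le {d a δ b : ℕ} (hd : a + δ + b = d)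
    (X : Finset (FreeAlgebra F (Fin n))) (hX : ∀ x ∈ X, x ∈ homogeneous F n δ)
    {p : FreeAlgebra F (Fin n)}
    (hp : p ∈ homogeneous F n a * Submodule.span F (X : Set (FreeAlgebra F (Fin n))) *
      homogeneous F n b) :
    flatRank (tensor d p) (interval d a δ) ≤ X.card := by
  classical
  suffices h : ∃ Q : FreeAlgebra F (Fin n) → (Fin d → Fin n) → F, ∀ m m',
      tensor d p ((interval d a δ).piecewise m m') =
        ∑ x ∈ X, coef (((List.ofFn m).drop a).take δ) x * Q x m' by
    obtain ⟨Q, hQ⟩ := h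
    exact flatRank_le_card X _ Q hQ
  rw [← Submodule.span_eq (homogeneous F n a), ← Submodule.span_eq (homogeneous F n b),
    Submodule.span_mul_span, Submodule.span_mul_span] at hp
  induction hp using Submodule.span_induction with
  | mem z hz =>
    obtain ⟨_, ⟨p, hp, x, hx, rfl⟩, q, hq, rfl⟩ := hz
    refine ⟨fun y m' => if y = x then
      coef ((List.ofFn m').take a) p * coef ((List.ofFn m').drop (a + δ)) q else 0, fun m m' => ?_⟩
    simp only [mul_ite, mul_zero, Finset.sum_ite_eq', if_pos (Finset.mem_coe.1 hx)]
    set w := (interval d a δ).piecewise m m' with hw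
    have e1 : (List.ofFn w).take a = (List.ofFn m').take a := by
      refine List.ext_getElem (by simp) fun i h1 h2 => ?_
      simp only [List.length_take, List.length_ofFn] at h1
      simp only [List.getElem_take, List.getElem_ofFn, hw]
      rw [Finset.piecewise_eq_of_notMem]
      simp only [interval, Finset.mem_filter, Finset.mem_univ, true_and]
      omega
    have e2 : ((List.ofFn w).drop a).take δ = ((List.ofFn m).drop a).take δ := by
      refine List.ext_getElem (by simp) fun i h1 h2 => ?_
      simp only [List.length_take, List.length_drop, List.length_ofFn] at h1
      simp only [List.getElem_take, List.getElem_drop, List.getElem_ofFn, hw]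
      rw [Finset.piecewise_eq_of_mem]
      simp only [interval, Finset.mem_filter, Finset.mem_univ, true_and]
      omega
    have e3 : (List.ofFn w).drop (a + δ) = (List.ofFn m').drop (a + δ) := by
      refine List.ext_getElem (by simp) fun i h1 h2 => ?_
      simp only [List.length_drop, List.length_ofFn] at h1
      simp only [List.getElem_drop, List.getElem_ofFn, hw]
      rw [Finset.piecewise_eq_of_notMem]
      simp only [interval, Finset.mem_filter, Finset.mem_univ, true_and]
      omega
    have e : List.ofFn w = ((List.ofFn m').take a ++ ((List.ofFn m).drop a).take δ) ++
        (List.ofFn m').drop (a + δ) := by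
      rw [← e1, ← e2, ← e3, List.append_assoc, ← List.drop_drop, List.take_append_drop,
        List.take_append_drop]
    have l1 : ((List.ofFn m').take a).length = a := by simp; omega
    have l2 : (((List.ofFn m).drop a).take δ).length = δ := by simp; omega
    have l3 : ((List.ofFn m').drop (a + δ)).length = b := by simp; omega
    have hp' : p ∈ homogeneous F n ((List.ofFn m').take a).length := by rw [l1]; exact hp
    have hx' : x ∈ homogeneous F n (((List.ofFn m).drop a).take δ).length := by
      rw [l2]; exact hX x hx
    have hq' : q ∈ homogeneous F n ((List.ofFn m').drop (a + δ)).length := by rw [l3]; exact hq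
    rw [tensor, e, coef_append_mul (by rw [List.length_append]; exact mul_mem_homogeneous hp' hx') hq',
      coef_append_mul hp' hx']
    ring
  | zero => exact ⟨fun _ _ => 0, fun m m' => by simp [tensor]⟩
  | add x y _ _ hx hy =>
    obtain ⟨Q, hQ⟩ := hx
    obtain ⟨Q', hQ'⟩ := hy
    refine ⟨fun x m => Q x m + Q' x m, fun m m' => ?_⟩
    simp only [mul_add, Finset.sum_add_distrib, ← hQ, ← hQ']
    simp [tensor]
  | smul c x _ hx =>
    obtain ⟨Q, hQ⟩ := hx
    refine ⟨fun x m => c * Q x m, fun m m' => ?_⟩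
    simp only [mul_left_comm _ c, ← Finset.mul_sum, ← hQ]
    simp [tensor]

theorem tensor_ne_zero {d : ℕ} {p : FreeAlgebra F (Fin n)} (hp : p ∈ homogeneous F n d)
    (h0 : p ≠ 0) : tensor d p ≠ 0 := by
  obtain ⟨w, hw⟩ := exists_coef_ne_zero h0
  obtain rfl := length_eq_of_coef_ne_zero hp hw
  intro e
  refine hw ?_
  have := congrFun e w.get
  rwa [tensor, List.ofFn_get] at this

end Coefficients

/-! ### Shapes of gates -/

section Shapes

variable {F : Type*} {n : ℕ} {C : Circuit F n}

/-- Some parse tree below the gate `v` has shape `σ`. -/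
def Circuit.HasShape (C : Circuit F n) (v : Fin C.size) (σ : PTree Kind) : Prop :=
  ∃ T, C.IsPartialParseTree T ∧ T.label = v ∧ C.shape T = σ

/-- The gate `v` has a parse tree, and all its parse trees have shape `σ`. -/
def Circuit.Uniform (C : Circuit F n) (v : Fin C.size) (σ : PTree Kind) : Prop :=
  C.HasShape v σ ∧ ∀ τ, C.HasShape v τ → τ = σ

theorem shape_node (v : Fin C.size) (ts : List (PTree (Fin C.size))) :
    C.shape (.node v ts) = .node (C.gate v).kind (ts.map C.shape) := by
  rw [Circuit.shape, PTree.map]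
  rfl

theorem hasShape_var {v : Fin C.size} {i : Fin n} (h : C.gate v = .var i) {σ : PTree Kind} :
    C.HasShape v σ ↔ σ = .node .var [] := by
  constructor
  · rintro ⟨_, ⟨v', ts, hts, hv⟩, rfl, rfl⟩
    simp only [PTree.label] at h
    simp only [Circuit.Chooses, h, List.map_eq_nil_iff] at hv
    rw [shape_node, h, hv]
    rfl
  · rintro rfl
    refine ⟨.node v [], .node v [] (by simp) (by simp [Circuit.Chooses, h]), rfl, ?_⟩
    rw [shape_node, h]
    rfl

theorem hasShape_const {v : Fin C.size} {c : F} (h : C.gate v = .const c) {σ : PTree Kind} :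
    C.HasShape v σ ↔ σ = .node .const [] := by
  constructor
  · rintro ⟨_, ⟨v', ts, hts, hv⟩, rfl, rfl⟩
    simp only [PTree.label] at h
    simp only [Circuit.Chooses, h, List.map_eq_nil_iff] at hv
    rw [shape_node, h, hv]
    rfl
  · rintro rfl
    refine ⟨.node v [], .node v [] (by simp) (by simp [Circuit.Chooses, h]), rfl, ?_⟩
    rw [shape_node, h]
    rfl

theorem hasShape_add {v : Fin C.size} {cs : List (Fin v)} (h : C.gate v = .add cs)
    {σ : PTree Kind} :
    C.HasShape v σ ↔ ∃ u ∈ cs, ∃ τ, C.HasShape (below v u) τ ∧ σ = .node .add [τ] := by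
  constructor
  · rintro ⟨_, ⟨v', ts, hts, hv⟩, rfl, rfl⟩
    simp only [PTree.label] at h cs
    simp only [Circuit.Chooses, h] at hv
    obtain ⟨u, hu, e⟩ := hv
    obtain ⟨t, rfl, ht⟩ := List.map_eq_singleton_iff.1 e
    refine ⟨u, hu, C.shape t, ⟨t, hts t (by simp), ht, rfl⟩, ?_⟩
    rw [shape_node, h]
    rfl
  · rintro ⟨u, hu, τ, ⟨T, hT, hl, rfl⟩, rfl⟩
    refine ⟨.node v [T], .node v [T] (by simpa using hT) ?_, rfl, ?_⟩
    · simp only [Circuit.Chooses, h]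
      exact ⟨u, hu, by simp [hl]⟩
    · rw [shape_node, h]
      rfl

theorem hasShape_mul {v : Fin C.size} {cs : List (Fin v)} (h : C.gate v = .mul cs)
    {σ : PTree Kind} :
    C.HasShape v σ ↔ ∃ τs, List.Forall₂ (fun u τ => C.HasShape (below v u) τ) cs τs ∧
      σ = .node .mul τs := by
  constructor
  · rintro ⟨_, ⟨v', ts, hts, hv⟩, rfl, rfl⟩
    simp only [PTree.label] at h cs
    simp only [Circuit.Chooses, h] at hv
    refine ⟨ts.map C.shape, ?_, ?_⟩
    · clear h
      induction ts generalizing cs with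
      | nil =>
        simp only [List.map_nil, List.nil_eq, List.map_eq_nil_iff] at hv
        subst hv
        exact .nil
      | cons t ts ih =>
        cases cs with
        | nil => simp at hv
        | cons u cs =>
          simp only [List.map_cons, List.cons.injEq] at hv
          exact .cons ⟨t, hts t (by simp), hv.1, rfl⟩
            (ih (fun t ht => hts t (by simp [ht])) (cs := cs) hv.2)
    · rw [shape_node, h]
      rfl
  · rintro ⟨τs, hτ, rfl⟩
    obtain ⟨ts, h1, h2, h3⟩ : ∃ ts : List (PTree (Fin C.size)), (∀ t ∈ ts, C.IsPartialParseTree t) ∧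
        ts.map PTree.label = cs.map (below v) ∧ ts.map C.shape = τs := by
      clear h
      induction hτ with
      | nil => exact ⟨[], by simp⟩
      | cons h _ ih =>
        obtain ⟨ts, h1, h2, h3⟩ := ih
        obtain ⟨T, hT, hl, hs⟩ := h
        exact ⟨T :: ts, by simpa using ⟨hT, h1⟩, by simp [hl, h2], by simp [hs, h3]⟩
    refine ⟨.node v ts, .node v ts h1 ?_, rfl, ?_⟩
    · simp only [Circuit.Chooses, h]
      exact h2
    · rw [shape_node, h, h3]
      rfl

/-- A second choice at one place, with the other entries kept, would give a second list. -/
theorem forall₂_unique {α β : Type*} {R : α → β → Prop} {as : List α} {bs : List β}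
    (h : List.Forall₂ R as bs) (hu : ∀ bs', List.Forall₂ R as bs' → bs' = bs) :
    List.Forall₂ (fun a b => R a b ∧ ∀ b', R a b' → b' = b) as bs := by
  induction h with
  | nil => exact .nil
  | cons h hs ih =>
    refine .cons ⟨h, fun b' hb' => ?_⟩ (ih fun bs' hbs' => ?_)
    · exact (List.cons.inj (hu _ (.cons hb' hs))).1
    · exact (List.cons.inj (hu _ (.cons h hbs'))).2

theorem Circuit.Uniform.mul {v : Fin C.size} {cs : List (Fin v)} (hg : C.gate v = .mul cs)
    {σ : PTree Kind} (h : C.Uniform v σ) : ∃ τs, σ = .node .mul τs ∧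
      List.Forall₂ (fun u τ => C.Uniform (below v u) τ) cs τs := by
  obtain ⟨τs, hτ, rfl⟩ := (hasShape_mul hg).1 h.1
  refine ⟨τs, rfl, forall₂_unique hτ fun τs' hτs' => ?_⟩
  have := h.2 _ ((hasShape_mul hg).2 ⟨τs', hτs', rfl⟩)
  simpa using this

/-! ### Values of gates with a unique shape -/

variable [Field F]

theorem val_var {v : Fin C.size} {i : Fin n} (h : C.gate v = .var i) :
    C.val v = FreeAlgebra.ι F i := by
  rw [Circuit.val, h]

theorem val_const {v : Fin C.size} {c : F} (h : C.gate v = .const c) :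
    C.val v = algebraMap F (FreeAlgebra F (Fin n)) c := by
  rw [Circuit.val, h]

theorem val_add {v : Fin C.size} {cs : List (Fin v)} (h : C.gate v = .add cs) :
    C.val v = (cs.map fun u => C.val (below v u)).sum := by
  rw [Circuit.val, h]

theorem val_mul {v : Fin C.size} {cs : List (Fin v)} (h : C.gate v = .mul cs) :
    C.val v = (cs.map fun u => C.val (below v u)).prod := by
  rw [Circuit.val, h]

/-- Parse trees are blocked by empty sums, which have value zero. The UPT condition says nothing
about such gates, so they must be seen to contribute nothing. -/
theorem val_eq_zero_of_no_shape (v : Fin C.size) (h : ∀ σ, ¬ C.HasShape v σ) : C.val v = 0 := by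
  induction hN : v.val using Nat.strong_induction_on generalizing v with
  | _ N ih =>
    subst hN
    cases hg : C.gate v with
    | var i => exact absurd ((hasShape_var hg).2 rfl) (h _)
    | const c => exact absurd ((hasShape_const hg).2 rfl) (h _)
    | add cs =>
      rw [val_add hg]
      refine List.sum_eq_zero fun x hx => ?_
      obtain ⟨u, hu, rfl⟩ := List.mem_map.1 hx
      exact ih _ u.isLt _ (fun τ hτ => h _ ((hasShape_add hg).2 ⟨u, hu, τ, hτ, rfl⟩)) rfl
    | mul cs =>
      rw [val_mul hg]
      by_contra hc
      have : ∀ u ∈ cs, ∃ τ, C.HasShape (below v u) τ := by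
        intro u hu
        by_contra! hn
        exact hc (List.prod_eq_zero (List.mem_map.2 ⟨u, hu, ih _ u.isLt _ hn rfl⟩))
      obtain ⟨τs, hτs⟩ : ∃ τs, List.Forall₂ (fun u τ => C.HasShape (below v u) τ) cs τs := by
        clear hg hc
        induction cs with
        | nil => exact ⟨[], .nil⟩
        | cons u cs ih' =>
          obtain ⟨τ, hτ⟩ := this u (by simp)
          obtain ⟨τs, hτs⟩ := ih' fun u hu => this u (by simp [hu])
          exact ⟨τ :: τs, .cons hτ hτs⟩
      exact h _ ((hasShape_mul hg).2 ⟨τs, hτs, rfl⟩)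

theorem Circuit.Uniform.add {v : Fin C.size} {cs : List (Fin v)} (hg : C.gate v = .add cs)
    {σ : PTree Kind} (h : C.Uniform v σ) : ∃ τ, σ = .node .add [τ] ∧
      (∃ u ∈ cs, C.Uniform (below v u) τ) ∧
      ∀ u ∈ cs, C.Uniform (below v u) τ ∨ C.val (below v u) = 0 := by
  obtain ⟨u, hu, τ, hτ, rfl⟩ := (hasShape_add hg).1 h.1
  have key : ∀ u ∈ cs, ∀ τ', C.HasShape (below v u) τ' → τ' = τ := by
    intro u hu τ' hτ'
    have := h.2 _ ((hasShape_add hg).2 ⟨u, hu, τ', hτ', rfl⟩)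
    simpa using this
  refine ⟨τ, rfl, ⟨u, hu, hτ, key u hu⟩, fun u hu => ?_⟩
  by_cases hs : C.HasShape (below v u) τ
  · exact Or.inl ⟨hs, key u hu⟩
  · exact Or.inr (val_eq_zero_of_no_shape _ fun τ' hτ' => hs (key u hu τ' hτ' ▸ hτ'))

/-- The number of variable leaves of a shape. -/
def numVars : PTree Kind → ℕ
  | .node .var _ => 1
  | .node _ ts => (ts.map fun t => numVars t).sum

theorem prod_mem_homogeneous {xs : List (FreeAlgebra F (Fin n))} {δs : List ℕ}
    (h : List.Forall₂ (fun x δ => x ∈ homogeneous F n δ) xs δs) :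
    xs.prod ∈ homogeneous F n δs.sum := by
  induction h with
  | nil => exact one_mem_homogeneous
  | cons h _ ih =>
    rw [List.prod_cons, List.sum_cons]
    exact mul_mem_homogeneous h ih

theorem Circuit.Uniform.val_mem {v : Fin C.size} {σ : PTree Kind} (h : C.Uniform v σ) :
    C.val v ∈ homogeneous F n (numVars σ) := by
  induction hN : v.val using Nat.strong_induction_on generalizing v σ with
  | _ N ih =>
    subst hN
    cases hg : C.gate v with
    | var i =>
      rw [(hasShape_var hg).1 h.1, val_var hg, numVars]
      exact ι_mem_homogeneous i
    | const c =>
      rw [(hasShape_const hg).1 h.1, val_const hg, Algebra.algebraMap_eq_smul_one]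
      exact Submodule.smul_mem _ _ (by simpa [numVars] using one_mem_homogeneous)
    | add cs =>
      obtain ⟨τ, rfl, -, hcs⟩ := h.add hg
      rw [val_add hg]
      refine list_sum_mem fun x hx => ?_
      obtain ⟨u, hu, rfl⟩ := List.mem_map.1 hx
      rcases hcs u hu with h' | h'
      · have := ih _ u.isLt h' rfl
        simpa [numVars] using this
      · rw [h']
        exact Submodule.zero_mem _
    | mul cs =>
      obtain ⟨τs, rfl, hcs⟩ := h.mul hg
      rw [val_mul hg]
      have : numVars (.node .mul τs) = (τs.map numVars).sum := by simp [numVars]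
      rw [this]
      refine prod_mem_homogeneous ?_
      rw [List.forall₂_map_left_iff, List.forall₂_map_right_iff]
      exact hcs.imp fun u τ hu => ih _ u.isLt hu rfl

end Shapes

/-! ### The tree of positions of a UPT circuit -/

section CircuitTree

variable {F : Type*} [Field F] {n : ℕ} {C : Circuit F n}

theorem mul_span_mul_le {a b p q : ℕ} {X Y : Set (FreeAlgebra F (Fin n))}
    (h : ∀ x ∈ X, x ∈ homogeneous F n p * Submodule.span F Y * homogeneous F n q) :
    homogeneous F n a * Submodule.span F X * homogeneous F n b ≤
      homogeneous F n (a + p) * Submodule.span F Y * homogeneous F n (q + b) :=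
  calc _ ≤ homogeneous F n a * (homogeneous F n p * Submodule.span F Y * homogeneous F n q) *
        homogeneous F n b :=
        mul_le_mul' (mul_le_mul' le_rfl (Submodule.span_le.2 h)) le_rfl
    _ = (homogeneous F n a * homogeneous F n p) * Submodule.span F Y *
        (homogeneous F n q * homogeneous F n b) := by simp only [mul_assoc]
    _ ≤ _ := mul_le_mul' (mul_le_mul' (homogeneous_mul_le _ _) le_rfl)
        (homogeneous_mul_le _ _)

theorem flatRank_gates_le {d a δ b : ℕ} (hd : a + δ + b = d) (X : Finset (Fin C.size))
    (g : Fin C.size → FreeAlgebra F (Fin n)) (hg : ∀ v ∈ X, g v ∈ homogeneous F n δ)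
    {p : FreeAlgebra F (Fin n)} (hp : p ∈ homogeneous F n a *
      Submodule.span F (g '' X) * homogeneous F n b) :
    flatRank (tensor d p) (interval d a δ) ≤ C.size := by
  classical
  refine (flatRank_interval_le hd (X.image g) ?_ (by simpa using hp)).trans
    (Finset.card_image_le.trans ((Finset.card_le_univ X).trans (by simp)))
  intro x hx
  obtain ⟨v, hv, rfl⟩ := Finset.mem_image.1 hx
  exact hg v hv

theorem Circuit.Uniform.mul_children {v : Fin C.size} {τs : List (PTree Kind)}
    (h : C.Uniform v (.node .mul τs)) : ∃ us : List (Fin C.size), C.val v = (us.map C.val).prod ∧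
      List.Forall₂ C.Uniform us τs ∧ ∀ u ∈ us, u < v := by
  cases hg : C.gate v with
  | var i => simpa using (hasShape_var hg).1 h.1
  | const c => simpa using (hasShape_const hg).1 h.1
  | add cs =>
    obtain ⟨τ, e, -⟩ := h.add hg
    simp at e
  | mul cs =>
    obtain ⟨τs', e, hcs⟩ := h.mul hg
    simp only [PTree.node.injEq, true_and] at e
    subst e
    refine ⟨cs.map (below v), by rw [val_mul hg, List.map_map]; rfl, ?_, ?_⟩
    · rwa [List.forall₂_map_left_iff]
    · intro u hu
      obtain ⟨w, -, rfl⟩ := List.mem_map.1 hu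
      exact w.isLt

theorem Circuit.Uniform.add_children {v : Fin C.size} {ts : List (PTree Kind)}
    (h : C.Uniform v (.node .add ts)) : ∃ τ, ts = [τ] ∧ (∃ u < v, C.Uniform u τ) ∧
      C.val v ∈ Submodule.span F (C.val '' {u | u < v ∧ C.Uniform u τ}) := by
  cases hg : C.gate v with
  | var i => simpa using (hasShape_var hg).1 h.1
  | const c => simpa using (hasShape_const hg).1 h.1
  | add cs =>
    obtain ⟨τ, e, ⟨u, -, hu⟩, hcs⟩ := h.add hg
    refine ⟨τ, by simpa using e, ⟨_, u.isLt, hu⟩, ?_⟩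
    rw [val_add hg]
    refine list_sum_mem fun x hx => ?_
    obtain ⟨w, hw, rfl⟩ := List.mem_map.1 hx
    rcases hcs w hw with h' | h'
    · exact Submodule.subset_span ⟨_, ⟨w.isLt, h'⟩, rfl⟩
    · rw [h']
      exact Submodule.zero_mem _
  | mul cs =>
    obtain ⟨τs', e, hcs⟩ := h.mul hg
    simp at e

theorem Circuit.Uniform.prod_mem {us : List (Fin C.size)} {τs : List (PTree Kind)}
    (h : List.Forall₂ C.Uniform us τs) :
    (us.map C.val).prod ∈ homogeneous F n (τs.map numVars).sum := by
  refine prod_mem_homogeneous ?_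
  rw [List.forall₂_map_left_iff, List.forall₂_map_right_iff]
  exact h.imp fun u τ hu => hu.val_mem

/-- The induction carries a set `X` of gates of one shape instead of a single gate, because a sum
gate spreads over many gates at the same place. Its cardinality never exceeds the size of the
circuit, which bounds every rank. -/
theorem posTree_of_uniform {d : ℕ} {p : FreeAlgebra F (Fin n)} (N : ℕ) :
    ∀ (X : Finset (Fin C.size)) (σ : PTree Kind), X.Nonempty → (∀ v ∈ X, v.val < N) →
      (∀ v ∈ X, C.Uniform v σ) → ∀ a b : ℕ, a + numVars σ + b = d →
      p ∈ homogeneous F n a * Submodule.span F (C.val '' X) * homogeneous F n b →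
      PosTree (fun I => flatRank (tensor d p) I ≤ C.size) (interval d a (numVars σ)) := by
  classical
  induction N with
  | zero =>
    intro X σ ⟨v, hv⟩ hN
    exact absurd (hN v hv) (by omega)
  | succ N ih =>
    intro X σ hX hN hσ a b hd hp
    have rank := flatRank_gates_le hd X C.val (fun v hv => (hσ v hv).val_mem) hp
    have one : 1 ∈ homogeneous F n 0 := one_mem_homogeneous
    obtain ⟨v₀, hv₀⟩ := hX
    obtain ⟨k, τs⟩ := σ
    cases k with
    | var => exact .leaf _ (card_interval_le_one (by simp [numVars])) rank
    | const =>
      -- `numVars` sums over children even at a constant node; the gate `v₀` shows that there are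
      -- none.
      refine .leaf _ (card_interval_le_one ?_) rank
      cases hg : C.gate v₀ with
      | var i => simpa using (hasShape_var hg).1 (hσ v₀ hv₀).1
      | const c =>
        rw [(hasShape_const hg).1 (hσ v₀ hv₀).1]
        simp [numVars]
      | add cs =>
        obtain ⟨τ, e, -⟩ := (hσ v₀ hv₀).add hg
        simp at e
      | mul cs =>
        obtain ⟨τ, e, -⟩ := (hσ v₀ hv₀).mul hg
        simp at e
    | add =>
      obtain ⟨τ, rfl, ⟨u, hu, hτ⟩, -⟩ := (hσ v₀ hv₀).add_children
      have hnum : numVars (.node .add [τ]) = numVars τ := by simp [numVars]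
      rw [hnum] at hd ⊢
      refine ih (Finset.univ.filter fun u => u.val < N ∧ C.Uniform u τ) τ
        ⟨u, ?_⟩ (fun v hv => (Finset.mem_filter.1 hv).2.1)
        (fun v hv => (Finset.mem_filter.1 hv).2.2) a b hd ?_
      · have := hN v₀ hv₀
        simp only [Finset.mem_filter, Finset.mem_univ, true_and]
        exact ⟨by have : u.val < v₀.val := hu
                  omega, hτ⟩
      · have := mul_span_mul_le (a := a) (b := b) (p := 0) (q := 0) (X := C.val '' X)
          (Y := C.val '' (Finset.univ.filter fun u : Fin C.size => u.val < N ∧ C.Uniform u τ : Finset _)) (by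
          rintro _ ⟨v, hv, rfl⟩
          obtain ⟨τ', e, -, h⟩ := (hσ v hv).add_children
          obtain rfl : τ = τ' := by simpa using e
          rw [← one_mul (C.val v), ← mul_one (1 * C.val v)]
          refine Submodule.mul_mem_mul (Submodule.mul_mem_mul one ?_) one
          refine Submodule.span_mono (Set.image_mono fun u hu => ?_) h
          have h1 : u.val < v.val := hu.1
          have h2 := hN v hv
          simp only [Finset.coe_filter, Finset.mem_univ, true_and, Set.mem_ofPred_eq]
          exact ⟨by omega, hu.2⟩) hp
        simpa using this
    | mul =>
      have hL : ∀ v, ∃ us : List (Fin C.size), v ∈ X → C.val v = (us.map C.val).prod ∧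
          List.Forall₂ C.Uniform us τs ∧ ∀ u ∈ us, u < v := by
        intro v
        by_cases hv : v ∈ X
        · obtain ⟨us, h⟩ := (hσ v hv).mul_children
          exact ⟨us, fun _ => h⟩
        · exact ⟨[], fun h => absurd h hv⟩
      choose L hL using hL
      have hnum : numVars (.node .mul τs) = (τs.map numVars).sum := by simp [numVars]
      rw [hnum] at hd ⊢
      have split : ∀ i, ((τs.take i).map numVars).sum + ((τs.drop i).map numVars).sum =
          (τs.map numVars).sum := by
        intro i
        rw [← List.sum_append, ← List.map_append, List.take_append_drop]
      have hpre : ∀ i, ∀ v ∈ X, (((L v).take i).map C.val).prod ∈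
          homogeneous F n ((τs.take i).map numVars).sum := fun i v hv =>
        Circuit.Uniform.prod_mem (List.forall₂_take i (hL v hv).2.1)
      have hsuf : ∀ i, ∀ v ∈ X, (((L v).drop i).map C.val).prod ∈
          homogeneous F n ((τs.drop i).map numVars).sum := fun i v hv =>
        Circuit.Uniform.prod_mem (List.forall₂_drop i (hL v hv).2.1)
      -- A product gate is binarized by prefixes of its children. Partial products need not be
      -- gates, but there is one for each gate in `X`, so the rank bound is unchanged.
      have prefixRank : ∀ i, flatRank (tensor d p)
          (interval d a ((τs.take i).map numVars).sum) ≤ C.size := by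
        intro i
        refine flatRank_gates_le (b := ((τs.drop i).map numVars).sum + b)
          (by have := split i; omega) X (fun v => (((L v).take i).map C.val).prod) (hpre i) ?_
        refine mul_span_mul_le (p := 0) ?_ hp
        rintro _ ⟨v, hv, rfl⟩
        rw [(hL v hv).1, ← List.take_append_drop i (L v), List.map_append, List.prod_append,
          ← one_mul ((List.map C.val (List.take i (L v))).prod)]
        exact Submodule.mul_mem_mul (Submodule.mul_mem_mul one (Submodule.subset_span ⟨v, hv, rfl⟩))
          (hsuf i v hv)
      have main : ∀ i ≤ τs.length, PosTree (fun I => flatRank (tensor d p) I ≤ C.size)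
          (interval d a ((τs.take i).map numVars).sum) := by
        intro i
        induction i with
        | zero =>
          intro _
          exact .leaf _ (card_interval_le_one (by simp)) (prefixRank 0)
        | succ i ih' =>
          intro hi
          have hs : ((τs.take (i + 1)).map numVars).sum =
              ((τs.take i).map numVars).sum + numVars τs[i] := by
            rw [← List.take_concat_get' τs i hi, List.map_append, List.sum_append]
            simp
          have hchild : ∀ v ∈ X, ∃ h : i < (L v).length, C.Uniform (L v)[i] τs[i] ∧
              (L v)[i].val < N := by
            intro v hv
            have hlen := (hL v hv).2.1.length_eq
            refine ⟨by omega, (hL v hv).2.1.get (by omega) hi, ?_⟩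
            have h1 : (L v)[i].val < v.val := (hL v hv).2.2 _ (List.getElem_mem _)
            have h2 := hN v hv
            omega
          rw [hs, interval_add]
          refine .node _ _ (ih' (by omega)) ?_ (disjoint_interval _ _ _ _) ?_
          · refine ih (Finset.univ.filter fun u => u.val < N ∧ C.Uniform u τs[i]) τs[i]
              ?_ (fun v hv => (Finset.mem_filter.1 hv).2.1)
              (fun v hv => (Finset.mem_filter.1 hv).2.2) (a + ((τs.take i).map numVars).sum)
              (((τs.drop (i + 1)).map numVars).sum + b) ?_ ?_
            · obtain ⟨h, h1, h2⟩ := hchild v₀ hv₀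
              exact ⟨(L v₀)[i], by simp [h1, h2]⟩
            · have := split (i + 1)
              omega
            · refine mul_span_mul_le ?_ hp
              rintro _ ⟨v, hv, rfl⟩
              obtain ⟨h, h1, h2⟩ := hchild v hv
              have e : C.val v = (((L v).take i).map C.val).prod * C.val (L v)[i] *
                  (((L v).drop (i + 1)).map C.val).prod := by
                rw [(hL v hv).1, ← List.prod_take_mul_prod_drop _ (i + 1),
                  List.prod_take_succ _ _ (by simpa using h), List.getElem_map, List.map_take,
                  List.map_drop]
              rw [e]
              refine Submodule.mul_mem_mul (Submodule.mul_mem_mul (hpre i v hv)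
                (Submodule.subset_span ⟨_, ?_, rfl⟩)) (hsuf (i + 1) v hv)
              simp [h1, h2]
          · rw [← interval_add, ← hs]
            exact prefixRank (i + 1)
      have := main τs.length le_rfl
      rwa [List.take_length] at this

theorem Circuit.IsUPT.posTree (hC : C.IsUPT) {d : ℕ} (hd : C.poly ∈ homogeneous F n d)
    (h0 : C.poly ≠ 0) :
    PosTree (fun I => flatRank (tensor d C.poly) I ≤ C.size) (Finset.univ : Finset (Fin d)) := by
  obtain ⟨σ, hσ⟩ : ∃ σ, C.HasShape C.root σ := by
    by_contra! hc
    exact h0 (val_eq_zero_of_no_shape _ hc)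
  have hU : C.Uniform C.root σ := by
    refine ⟨hσ, ?_⟩
    rintro _ ⟨T, hT, hl, rfl⟩
    obtain ⟨T', hT', hl', rfl⟩ := hσ
    exact hC T T' ⟨hT, hl⟩ ⟨hT', hl'⟩
  obtain ⟨w, hw⟩ := exists_coef_ne_zero h0
  -- Both degrees are the length of a word with nonzero coefficient.
  have e : numVars σ = d := by
    rw [← length_eq_of_coef_ne_zero hd hw, length_eq_of_coef_ne_zero hU.val_mem hw]
  have := posTree_of_uniform (d := d) (p := C.poly) C.size {C.root} σ (by simp)
    (fun v _ => v.isLt) (by simpa using hU) 0 0 (by omega) (by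
      rw [← one_mul C.poly, ← mul_one (1 * C.poly)]
      exact Submodule.mul_mem_mul (Submodule.mul_mem_mul one_mem_homogeneous
        (Submodule.subset_span ⟨C.root, by simp, rfl⟩)) one_mem_homogeneous)
  have hu : interval d 0 (numVars σ) = Finset.univ := by
    ext j
    simp [interval, e]
  rwa [hu] at this

end CircuitTree

/-! ### Evaluation at the points of the hitting set -/

section Evaluation

variable {F K : Type*} [Field F] [Field K] [Algebra F K] {n d : ℕ}

/-- The product of the values of `y` along a word whose first position is `a`. -/
def pathProd (y : ℕ → Fin n → K) : ℕ → List (Fin n) → K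
  | _, [] => 1
  | a, i :: w => y a i * pathProd y (a + 1) w

theorem pathProd_ofFn (y : ℕ → Fin n → K) (a : ℕ) {d : ℕ} (m : Fin d → Fin n) :
    pathProd y a (List.ofFn m) = ∏ j, y (a + j.val) (m j) := by
  induction d generalizing a with
  | zero => simp [pathProd]
  | succ d ih =>
    rw [List.ofFn_succ, pathProd, ih, Fin.prod_univ_succ]
    congr 1
    refine Finset.prod_congr rfl fun j _ => ?_
    rw [Fin.val_succ, add_assoc, add_comm 1]

/-- The matrices are weighted adjacency matrices of a path, so from `a` there is exactly one walk of
each length and it records the positions of the letters. -/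
theorem list_prod_apply {y : ℕ → Fin n → K} {h : Fin n → Matrix (Fin (d + 1)) (Fin (d + 1)) K}
    (hh : ∀ i a b, h i a b = if b.val = a.val + 1 then y a.val i else 0) (w : List (Fin n))
    (a b : Fin (d + 1)) :
    (w.map h).prod a b = if b.val = a.val + w.length then pathProd y a w else 0 := by
  induction w generalizing a with
  | nil =>
    simp [Matrix.one_apply, pathProd, Fin.ext_iff, eq_comm]
  | cons i w ih =>
    rw [List.map_cons, List.prod_cons, Matrix.mul_apply]
    by_cases ha : a.val + 1 < d + 1
    · rw [Finset.sum_eq_single ⟨a.val + 1, ha⟩]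
      · rw [hh, if_pos rfl, ih, pathProd]
        simp only [mul_ite, mul_zero, List.length_cons]
        congr 1
        rw [add_assoc, add_comm 1]
      · intro c _ hc
        rw [hh, if_neg fun e => hc (Fin.ext e), zero_mul]
      · simp
    · rw [Finset.sum_eq_zero, if_neg]
      · have := b.isLt
        rw [List.length_cons]
        omega
      · intro c _
        have := c.isLt
        rw [hh, if_neg (by omega), zero_mul]

theorem lift_apply_zero_last {y : ℕ → Fin n → K}
    {h : Fin n → Matrix (Fin (d + 1)) (Fin (d + 1)) K}
    (hh : ∀ i a b, h i a b = if b.val = a.val + 1 then y a.val i else 0)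
    {p : FreeAlgebra F (Fin n)} (hp : p ∈ homogeneous F n d) :
    FreeAlgebra.lift F h p 0 (Fin.last d) =
      ∑ m : Fin d → Fin n, algebraMap F K (tensor d p m) * ∏ j : Fin d, y j (m j) := by
  refine homogeneous_induction (P := fun p => FreeAlgebra.lift F h p 0 (Fin.last d) =
    ∑ m : Fin d → Fin n, algebraMap F K (tensor d p m) * ∏ j : Fin d, y j (m j))
    (fun w hw => ?_) (by simp [tensor]) (fun p q e e' => ?_) (fun c p e => ?_) hp
  · obtain ⟨m, rfl⟩ : ∃ m : Fin d → Fin n, w = List.ofFn m := by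
      subst hw
      exact ⟨w.get, (List.ofFn_get w).symm⟩
    rw [Finset.sum_eq_single m]
    · rw [tensor, coef_word, if_pos rfl, map_one, one_mul, word, map_list_prod, List.map_map]
      have e : (FreeAlgebra.lift F h) ∘ FreeAlgebra.ι F = h := FreeAlgebra.ι_comp_lift h
      rw [e, list_prod_apply hh, if_pos (by simp), pathProd_ofFn]
      simp
    · intro m' _ hm'
      rw [tensor, coef_word, if_neg fun e => hm' (List.ofFn_injective e).symm, map_zero, zero_mul]
    · simp
  · simp only [tensor, map_add, add_mul, Finset.sum_add_distrib, Matrix.add_apply] at e e' ⊢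
    rw [e, e']
  · simp only [tensor, map_smul, smul_eq_mul, map_mul, mul_assoc, ← Finset.mul_sum,
      Matrix.smul_apply] at e ⊢
    rw [e, Algebra.smul_def]

theorem point_output (α : K) {c r s k : ℕ} (hk : k < numPoints c r d n s) (j : Fin n)
    (a b : Fin (d + 1)) : point α n (d + 1) (output c r d n s) k j a b =
      if b.val = a.val + 1 then α ^ expo (digitBase c d n s) k (a.val * n + j.val) else 0 := by
  have hj := j.isLt
  have ha := a.isLt
  have hb := b.isLt
  have h1 : ∀ u v w : ℕ, v < w → (u * w + v) % w = v ∧ (u * w + v) / w = u := by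
    intro u v w h
    rw [add_comm, mul_comm]
    exact ⟨by rw [Nat.add_mul_mod_self_left, Nat.mod_eq_of_lt h],
      by rw [Nat.add_mul_div_left _ _ (by omega), Nat.div_eq_of_lt h, zero_add]⟩
  have hlt : ∀ u v w M : ℕ, u < M → v < w → u * w + v < M * w := by
    intro u v w M hu hv
    have : (u + 1) * w ≤ M * w := Nat.mul_le_mul_right _ hu
    nlinarith
  have hx : ((k * n + j.val) * (d + 1) + a.val) * (d + 1) + b.val <
      numPoints c r d n s * (n * ((d + 1) * (d + 1))) := by
    rw [← mul_assoc, ← mul_assoc]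
    exact hlt _ _ _ _ (hlt _ _ _ _ (hlt _ _ _ _ hk hj) ha) hb
  simp only [point, Matrix.of_apply, output]
  rw [List.getD_eq_getElem _ _ (by simpa using hx), List.getElem_map, List.getElem_range, printed,
    (h1 _ _ _ hb).1, (h1 _ _ _ hb).2, (h1 _ _ _ ha).1, (h1 _ _ _ ha).2, (h1 _ _ _ hj).1,
    (h1 _ _ _ hj).2]
  split_ifs <;> rfl

end Evaluation

/-! ### Every list of digits is the list of digits of some number -/

section Digits

/-- Digits from place `k` on vanish, since k < (Q³)^k, and a zero digit has exponent zero. So the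
number of levels need not be known. -/
theorem expo_eq_sum_of_le {Q k M : ℕ} (hQ : 2 ≤ Q) (hM : k ≤ M) (t : ℕ) : expo Q k t =
    ∑ i ∈ Finset.range M, k / (Q ^ 3) ^ i % Q ^ 3 % Q *
      ((k / (Q ^ 3) ^ i % Q ^ 3 / Q % Q) ^ t % (k / (Q ^ 3) ^ i % Q ^ 3 / Q / Q + 1)) := by
  refine Finset.sum_subset (Finset.range_subset_range.2 hM) fun i _ hi => ?_
  have hlt : k < (Q ^ 3) ^ i := by
    have h1 : k ≤ i := by simpa using hi
    have h2 : 1 < Q ^ 3 := Nat.one_lt_pow (by norm_num) (by omega)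
    exact h1.trans_lt (Nat.lt_pow_self h2)
  rw [Nat.div_eq_of_lt hlt]
  simp

theorem expo_add_mul {Q x k : ℕ} (hQ : 2 ≤ Q) (hx : x < Q ^ 3) (t : ℕ) :
    expo Q (x + Q ^ 3 * k) t = x % Q * ((x / Q % Q) ^ t % (x / Q / Q + 1)) + expo Q k t := by
  have hpos : 0 < Q ^ 3 := by positivity
  have hkM : k ≤ x + Q ^ 3 * k := by nlinarith
  rw [expo_eq_sum_of_le hQ (Nat.le_succ _) t, Finset.sum_range_succ', add_comm,
    expo_eq_sum_of_le hQ hkM t]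
  congr 1
  · rw [pow_zero, Nat.div_one, Nat.add_mul_mod_self_left, Nat.mod_eq_of_lt hx]
  · refine Finset.sum_congr rfl fun i _ => ?_
    rw [pow_succ' (Q ^ 3) i, ← Nat.div_div_eq_div_mul, Nat.add_mul_div_left _ _ hpos, Nat.div_eq_of_lt hx,
      zero_add]

theorem exists_expo_eq {d n Q : ℕ} (hQ : 2 ≤ Q) (ts : List (ℕ × ℕ × ℕ))
    (hts : ∀ t ∈ ts, t.1 < Q ∧ t.2.1 < Q ∧ t.2.2 < Q) : ∃ k < (Q ^ 3) ^ ts.length,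
      ∀ (j : Fin d) (i : Fin n), expo Q k (j.val * n + i.val) = expWeight ts j i := by
  induction ts with
  | nil => exact ⟨0, by simp, fun j i => by simp [expo, expWeight]⟩
  | cons t ts ih =>
    obtain ⟨k, hk, h⟩ := ih fun t ht => hts t (by simp [ht])
    obtain ⟨h1, h2, h3⟩ := hts t (by simp)
    set x := t.1 + Q * (t.2.1 + Q * t.2.2) with hx
    have hQ0 : 0 < Q := by omega
    have hxQ : x < Q ^ 3 := by
      have e1 : t.2.1 + Q * t.2.2 + 1 ≤ Q * Q := by nlinarith
      have e2 : Q * (t.2.1 + Q * t.2.2 + 1) ≤ Q * (Q * Q) := Nat.mul_le_mul_left _ e1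
      rw [hx, show Q ^ 3 = Q * (Q * Q) by ring]
      rw [mul_add, mul_one] at e2
      omega
    refine ⟨x + Q ^ 3 * k, ?_, fun j i => ?_⟩
    · rw [List.length_cons, pow_succ' (Q ^ 3)]
      calc x + Q ^ 3 * k < Q ^ 3 * (k + 1) := by rw [mul_add, mul_one]; omega
        _ ≤ _ := Nat.mul_le_mul_left _ hk
    · rw [expo_add_mul hQ hxQ, h]
      simp only [expWeight, hashWeight]
      have d1 : x / Q = t.2.1 + Q * t.2.2 := by
        rw [hx, Nat.add_mul_div_left _ _ hQ0, Nat.div_eq_of_lt h1, zero_add]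
      rw [d1, hx, Nat.add_mul_mod_self_left, Nat.mod_eq_of_lt h1, Nat.add_mul_mod_self_left,
        Nat.mod_eq_of_lt h2, Nat.add_mul_div_left _ _ hQ0, Nat.div_eq_of_lt h2, zero_add]

end Digits

/-! ### The hitting set -/

/-- With b = snd + 1, |Z| ≤ b⁸·(b³)² = b¹⁴ and |Z|²·dn ≤ b²⁹. Bertrand's postulate gives a prime
between b²⁹ and b³⁰, and weights stay at most b³¹, below b³³. -/
theorem exists_hashBound {d n s : ℕ} (hd : 1 ≤ d) (hn : 1 ≤ n) (hs : 1 ≤ s)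
    (Z : Finset (Fin d → Fin n))
    (hZ : Z.card ≤ 2 ^ (4 * (Nat.log 2 d + 1)) * (s ^ 2 + n) ^ 2) :
    ∃ p, HashBound d n (digitBase 33 d n s) p ∧
      Set.InjOn (wt (hashWeight p.1 p.2) Finset.univ) (Z : Set (Fin d → Fin n)) := by
  obtain ⟨hd', hn', hs'⟩ := le_mul_mul hd hn hs
  have h1 := one_le_mul_mul hd hn hs
  have hdn : d * n ≤ s * n * d := by nlinarith
  rw [digitBase]
  set b := s * n * d + 1 with hb
  have hb2 : 2 ≤ b := by omega
  have hM : 2 ^ (4 * (Nat.log 2 d + 1)) ≤ b ^ 8 := by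
    have hlog : 2 ^ Nat.log 2 d ≤ b := (Nat.pow_log_le_self 2 (by omega)).trans (by omega)
    calc 2 ^ (4 * (Nat.log 2 d + 1)) = (2 * 2 ^ Nat.log 2 d) ^ 4 := by ring
      _ ≤ (b * b) ^ 4 := Nat.pow_le_pow_left (Nat.mul_le_mul hb2 hlog) 4
      _ = b ^ 8 := by ring
  have hR : s ^ 2 + n ≤ b ^ 3 := by
    have e1 : s ^ 2 ≤ b ^ 2 := Nat.pow_le_pow_left (by omega) 2
    have e2 : n ≤ b ^ 2 := by nlinarith
    calc s ^ 2 + n ≤ 2 * b ^ 2 := by omega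
      _ ≤ b * b ^ 2 := Nat.mul_le_mul_right _ hb2
      _ = b ^ 3 := by ring
  have hZ' : Z.card ≤ b ^ 14 := hZ.trans <| by
    calc _ ≤ b ^ 8 * (b ^ 3) ^ 2 := Nat.mul_le_mul hM (Nat.pow_le_pow_left hR 2)
      _ = b ^ 14 := by ring
  have hZ2 : Z.card ^ 2 * (d * n) ≤ b ^ 29 := by
    calc _ ≤ (b ^ 14) ^ 2 * b := Nat.mul_le_mul (Nat.pow_le_pow_left hZ' 2) (by omega)
      _ = b ^ 29 := by ring
  obtain ⟨p, hp, hlt, hle⟩ := Nat.exists_prime_lt_and_le_two_mul (b ^ 29) (by positivity)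
  have hp30 : p ≤ b ^ 30 := hle.trans <| by
    calc 2 * b ^ 29 ≤ b * b ^ 29 := Nat.mul_le_mul_right _ hb2
      _ = b ^ 30 := by ring
  have hp33 : b ^ 30 < b ^ 33 := Nat.pow_lt_pow_right (by omega) (by norm_num)
  obtain ⟨k, hk, hinj⟩ := exists_hashWeight_injOn hp Z (hZ2.trans_lt hlt)
  refine ⟨(k, p - 1), ⟨by simp only; omega, by simp only; omega, fun m => ?_⟩, hinj⟩
  calc _ ≤ d * (p - 1) := wt_hashWeight_le _ _ m
    _ ≤ b * b ^ 30 := Nat.mul_le_mul (by omega) (by omega)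
    _ = b ^ 31 := by ring
    _ < b ^ 33 := Nat.pow_lt_pow_right (by omega) (by norm_num)

theorem isHittingSet_output {d n s : ℕ} (hd : 1 ≤ d) (hn : 1 ≤ n) (hs : 1 ≤ s)
    {F K : Type*} [Field F] [Field K] [Algebra F K] {α : K}
    (hα : ∀ i j : ℕ, i < digitBase 33 d n s → j < digitBase 33 d n s → α ^ i = α ^ j → i = j) :
    IsHittingSet (computable F d n s)
      (pointSet α n (d + 1) (numPoints 33 15 d n s) (output 33 15 d n s)) := by
  rintro f ⟨hf, C, hC, hCs, rfl⟩ h0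
  have hQ : 2 ≤ digitBase 33 d n s := by
    have := one_le_mul_mul hd hn hs
    exact (show 2 ≤ s * n * d + 1 by omega).trans (Nat.le_self_pow (by norm_num) _)
  -- In the bound R = s² + n, the square covers differences of tree sets and n covers the words on
  -- at most one position.
  have hCR : C.size * C.size ≤ s ^ 2 + n := by nlinarith
  have dec := (decomp_of_tree (D := fun I => flatRank (tensor d C.poly) I ≤ s ^ 2 + n)
    (fun I hI => hI.trans (by nlinarith))
    (fun I K hKI hI hK => (flatRank_sdiff_le hKI).trans ((Nat.mul_le_mul hI hK).trans hCR))
    (Nat.log 2 d + 1)).1 _ (hC.posTree hf h0)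
    (by simpa using (Nat.lt_pow_succ_log_self (by norm_num) d).le)
  obtain ⟨ps, hlen, hps, hiso⟩ := exists_levelWeight_isolates (tensor d C.poly) (⟨0, hn⟩ : Fin n)
    (b := digitBase 33 d n s) (M := 2 ^ (4 * (Nat.log 2 d + 1))) (R := s ^ 2 + n) (by omega)
    (by omega) (exists_hashBound hd hn hs) (4 * (Nat.log 2 d + 1)) {Finset.univ}
    (by simpa using dec) (by simp)
  obtain ⟨S, hS, -⟩ := hiso _ (Finset.mem_singleton_self _)
  obtain ⟨v, hv⟩ := hS.exists_sum_ne_zero (tensor_ne_zero hf h0)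
  obtain ⟨ts, htl, hts, hne⟩ := exists_expWeight hα ps hps
    (fun m => algebraMap F K (tensor d C.poly m)) v (by
      rw [← map_sum]
      exact fun h => hv ((map_eq_zero _).1 h))
  obtain ⟨k, hk, hexp⟩ := exists_expo_eq (d := d) (n := n) hQ ts hts
  have hk' : k < numPoints 33 15 d n s := by
    -- With L = log d + 1 there are 4L + 1 levels and three factors for each, and 3(4L + 1) ≤ 15L.
    refine hk.trans_le ?_
    rw [numPoints, ← pow_mul, ← pow_mul, htl, hlen]
    exact Nat.pow_le_pow_right (by omega) (by omega)
  refine ⟨_, ⟨k, hk', rfl⟩, fun hz => hne ?_⟩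
  have e := lift_apply_zero_last (y := fun a i => α ^ expo (digitBase 33 d n s) k (a * n + i.val))
    (h := point α n (d + 1) (output 33 15 d n s) k) (fun i a b => point_output α hk' i a b) hf
  rw [hz, Matrix.zero_apply] at e
  rw [e]
  refine Finset.sum_congr rfl fun m _ => ?_
  rw [Finset.prod_pow_eq_pow_sum, wt]
  simp only [hexp]

end UPT

theorem mainTheorem1 :
    ∃ (P : Turing.ToPartrec.Code) (c : ℕ),
      ∀ d n s : ℕ, 1 ≤ d → 1 ≤ n → 1 ≤ s →
        ∃ (L : List ℕ) (m : ℕ),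
          UPT.RunsInTime P [d, n, s] L ((s * n * d + 1) ^ (c * (Nat.log 2 d + 1))) ∧
          L.length = m * (n * ((d + 1) * (d + 1))) ∧
          m ≤ (s * n * d + 1) ^ (c * (Nat.log 2 d + 1)) ∧
          ∀ (F : Type*) [Field F] (K : Type*) [Field K] [Algebra F K] (α : K),
            (∀ i j : ℕ, i < (s * n * d + 1) ^ c → j < (s * n * d + 1) ^ c →
              α ^ i = α ^ j → i = j) →
            UPT.IsHittingSet (UPT.computable F d n s)
              (UPT.pointSet α n (d + 1) m L) := by
  obtain ⟨P, C, h⟩ := UPT.exists_program 33 15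
  -- One constant for three bounds: `C` for the time, 33 · 15 for the number of points, and at least
  -- 33 for the distinct powers of `α`.
  refine ⟨P, C + 33 * 15, fun d n s hd hn hs =>
    ⟨UPT.output 33 15 d n s, UPT.numPoints 33 15 d n s, ?_, by simp [UPT.output], ?_, ?_⟩⟩
  · obtain ⟨e⟩ := h d n s hd hn hs
    exact ⟨⟨e.toEvalsTo, e.steps_le_m.trans (Nat.pow_le_pow_right (Nat.succ_pos _)
      (Nat.mul_le_mul_right _ (Nat.le_add_right _ _)))⟩⟩
  · rw [UPT.numPoints, UPT.digitBase, ← pow_mul, ← pow_mul, ← mul_assoc]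
    exact Nat.pow_le_pow_right (Nat.succ_pos _) (Nat.mul_le_mul_right _ (Nat.le_add_left _ _))
  · intro F _ K _ _ α hα
    have hle : UPT.digitBase 33 d n s ≤ (s * n * d + 1) ^ (C + 33 * 15) :=
      Nat.pow_le_pow_right (Nat.succ_pos _) (by omega)
    exact UPT.isHittingSet_output hd hn hs fun i j hi hj =>
      hα i j (hi.trans_le hle) (hj.trans_le hle)
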